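/- Let $\Omega\subset\mathbb{R}^d$ be an open set of finite Lebesgue measure (for instance a bounded Lipschitz domain), and let $\mathbb{R}^{d\times d}_{\mathrm{sym}}$ be the space of symmetric matrices with the Frobenius norm and open unit ball $\mathbb{B}$. $\mathrm{BD}(\Omega)$ is the space of all $u\in L^1(\Omega;\mathbb{R}^d)$ whose distributional symmetrized derivative $Eu=\frac12(Du+Du^T)$ is a finite Radon measure on $\Omega$ with values in $\mathbb{R}^{d\times d}_{\mathrm{sym}}$; write $Eu=\mathcal{E}u\,\mathcal{L}^d+E^su$ for its Lebesgue decomposition, and let $\mathrm{LD}(\Omega)=\{u\in\mathrm{BD}(\Omega): E^su=0\}$. A sequence $(u_j)\subset\mathrm{BD}(\Omega)$ converges $\langle\cdot\rangle$-strictly to $u\in\mathrm{BD}(\Omega)$ if $u_j\to u$ in $L^1(\Omega;\mathbb{R}^d)$, $\int\psi\,\mathrm{d}Eu_j\to\int\psi\,\mathrm{d}Eu$ for all $\psi\in C_0(\Omega)$, and $\langle Eu_j\rangle(\Omega)\to\langle Eu\rangle(\Omega)$, where $\langle Eu\rangle(\Omega)=\int_\Omega\sqrt{1+|\mathcal{E}u|^2}\,\mathrm{d}x+|E^su|(\Omega)$.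 $\mathbf{E}(\Omega;\mathbb{R}^{d\times d}_{\mathrm{sym}})$ is the set of all continuous $f:\Omega\times\mathbb{R}^{d\times d}_{\mathrm{sym}}\to\mathbb{R}$ such that $(Sf)(x,A)=(1-|A|)\,f\bigl(x,\frac{A}{1-|A|}\bigr)$, $(x,A)\in\Omega\times\mathbb{B}$, extends to a bounded continuous function on $\overline{\Omega\times\mathbb{B}}$. Let $f\in\mathbf{E}(\Omega;\mathbb{R}^{d\times d}_{\mathrm{sym}})$. Then the recession function $$f^\infty(x,A)=\lim_{\substack{x'\to x,\ A'\to A\\ t\to\infty}}\frac{f(x',tA')}{t}\qquad(x'\in\Omega)$$ exists for all $x\in\overline\Omega$ and $A\in\mathbb{R}^{d\times d}_{\mathrm{sym}}$, and the $\langle\cdot\rangle$-strictly continuous extension to $\mathrm{BD}(\Omega)$ of the functional $$\mathcal{F}(u)=\int_\Omega f(x,\mathcal{E}u(x))\,\mathrm{d}x,\qquad u\in\mathrm{LD}(\Omega),$$ is $$\overline{\mathcal{F}}(u)=\int_\Omega f(x,\mathcal{E}u(x))\,\mathrm{d}x+\int_\Omega f^\infty\Bigl(x,\frac{\mathrm{d}E^su}{\mathrm{d}|E^su|}(x)\Bigr)\,\mathrm{d}|E^su|(x),\qquad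 u\in\mathrm{BD}(\Omega).$$ That is, both integrals converge absolutely for every $u\in\mathrm{BD}(\Omega)$, $\overline{\mathcal{F}}=\mathcal{F}$ on $\mathrm{LD}(\Omega)$, $\overline{\mathcal{F}}(u_j)\to\overline{\mathcal{F}}(u)$ whenever $u_j\to u$ $\langle\cdot\rangle$-strictly in $\mathrm{BD}(\Omega)$, and $\overline{\mathcal{F}}$ is the only real-valued functional on $\mathrm{BD}(\Omega)$ with the last two properties. -/

import Mathlib

open MeasureTheory Filter Topology
open scoped ContDiff

noncomputable section

namespace BoundedDeformation

/-- `ℝ^d` with the Euclidean norm. -/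
abbrev Vec (d : ℕ) : Type := EuclideanSpace ℝ (Fin d)

/-- The symmetric matrices, as a subspace of `ℝ^{d × d}` with the Euclidean (Frobenius) norm. -/
def symSubspace (d : ℕ) : Submodule ℝ (EuclideanSpace ℝ (Fin d × Fin d)) where
  carrier := {A | ∀ i j, A (i, j) = A (j, i)}
  add_mem' := fun {A B} hA hB i j => by
    simp only [PiLp.add_apply]
    rw [hA i j, hB i j]
  zero_mem' := fun i j => by simp
  smul_mem' := fun c A hA i j => by
    simp only [PiLp.smul_apply]
    rw [hA i j]

/-- The space of real symmetric `d × d` matrices with the Frobenius norm and inner product. -/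
def SymMat (d : ℕ) : Type := symSubspace d

instance (d : ℕ) : NormedAddCommGroup (SymMat d) :=
  inferInstanceAs (NormedAddCommGroup (symSubspace d))

instance (d : ℕ) : InnerProductSpace ℝ (SymMat d) :=
  inferInstanceAs (InnerProductSpace ℝ (symSubspace d))

instance (d : ℕ) : FiniteDimensional ℝ (SymMat d) :=
  inferInstanceAs (FiniteDimensional ℝ (symSubspace d))

instance (d : ℕ) : MeasurableSpace (SymMat d) := borel _

instance (d : ℕ) : BorelSpace (SymMat d) := ⟨rfl⟩

/-- The `(i, j)` entry of a symmetric matrix. -/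
def SymMat.entry {d : ℕ} (A : SymMat d) (i j : Fin d) : ℝ := A.1 (i, j)

section VectorMeasures

variable {X V : Type*} [MeasurableSpace X] [NormedAddCommGroup V] [InnerProductSpace ℝ V]
  [FiniteDimensional ℝ V]

/-- The `i`-th component of a vector measure with respect to an orthonormal basis of the target. -/
def component (μ : VectorMeasure X V) (i : Fin (Module.finrank ℝ V)) : SignedMeasure X :=
  μ.mapRange (innerSL ℝ (stdOrthonormalBasis ℝ V i)).toLinearMap.toAddMonoidHom
    (innerSL ℝ (stdOrthonormalBasis ℝ V i)).continuous

/-- The Radon-Nikodym density `dμ/dν` of a vector measure `μ` with respect to a positive measure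
`ν`, computed componentwise (the absolutely continuous part of `μ` is `(dμ/dν) ν`). -/
def density (μ : VectorMeasure X V) (ν : Measure X) (x : X) : V :=
  ∑ i, (component μ i).rnDeriv ν x • stdOrthonormalBasis ℝ V i

theorem integrable_density (μ : VectorMeasure X V) (ν : Measure X) :
    Integrable (density μ ν) ν :=
  integrable_finsetSum _ fun i _ =>
    (SignedMeasure.integrable_rnDeriv (component μ i) ν).smul_const _

/-- The singular part `μˢ = μ - (dμ/dν) ν` in the Lebesgue-Radon-Nikodym decomposition. -/
def singularPart (μ : VectorMeasure X V) (ν : Measure X) : VectorMeasure X V :=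
  μ - ν.withDensityᵥ (density μ ν)

end VectorMeasures

variable {d : ℕ}

/-- The area functional
`⟨μ⟩(Ω) = ∫_Ω √(1 + |dμ/dx|²) dx + |μˢ|(Ω)`, for `Ω` of finite Lebesgue measure. -/
def area (Ω : Set (Vec d)) (μ : VectorMeasure (Vec d) (SymMat d)) : ℝ :=
  (∫ x in Ω, √(1 + ‖density μ volume x‖ ^ 2)) + (singularPart μ volume).variation.real Ω

/-- `μ` is the distributional symmetrized derivative `(Du + Duᵀ)/2` on `Ω` of `u ∈ L¹(Ω; ℝ^d)`: a
finite Radon measure on `Ω` with values in the symmetric matrices (regarded as a measure on `ℝ^d`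
which is carried by `Ω`), with
`∫_Ω (u_i ∂_j φ + u_j ∂_i φ)/2 dx = - ∫ φ dμ_{ij}` for all `φ ∈ C_c^∞(Ω)` and all `i, j`. -/
structure IsSymDeriv (Ω : Set (Vec d)) (u : Lp (Vec d) 1 (volume.restrict Ω))
    (μ : VectorMeasure (Vec d) (SymMat d)) : Prop where
  finite : IsFiniteMeasure μ.variation
  carried : μ.variation Ωᶜ = 0
  integral_eq : ∀ φ : Vec d → ℝ, ContDiff ℝ ∞ φ → HasCompactSupport φ → tsupport φ ⊆ Ω →
    ∀ i j : Fin d,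
      ∫ x in Ω, (u x i * fderiv ℝ φ x (EuclideanSpace.single j 1)
          + u x j * fderiv ℝ φ x (EuclideanSpace.single i 1)) / 2
        = - (∫ᵛ x, φ x ∂•μ).entry i j

/-- An open subset of `ℝ^d` is exhausted by smooth cut-off functions. -/
theorem exists_cutoff {W : Set (Vec d)} (hW : IsOpen W) :
    ∃ φ : ℕ → Vec d → ℝ, (∀ n, ContDiff ℝ ∞ (φ n)) ∧ (∀ n, HasCompactSupport (φ n)) ∧
      (∀ n, tsupport (φ n) ⊆ W) ∧ (∀ n x, |φ n x| ≤ 1) ∧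
      ∀ x, Tendsto (fun n => φ n x) atTop (𝓝 (W.indicator (fun _ => (1 : ℝ)) x)) := by
  obtain ⟨F, hFc, hFW, hFU, hFm⟩ := hW.exists_iUnion_isClosed
  have key : ∀ n : ℕ, ∃ φ : Vec d → ℝ, ContDiff ℝ ∞ φ ∧ HasCompactSupport φ ∧ tsupport φ ⊆ W ∧
      (∀ x, |φ x| ≤ 1) ∧ ∀ x ∈ F n ∩ Metric.closedBall 0 n, φ x = 1 := by
    intro n
    have hK : IsCompact (F n ∩ Metric.closedBall 0 (n : ℝ)) :=
      (isCompact_closedBall _ _).inter_left (hFc n)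
    obtain ⟨L, hL, hKL, hLW⟩ :=
      exists_compact_between hK hW (Set.inter_subset_left.trans (hFW n))
    obtain ⟨φ, h0, h1, h01⟩ := exists_contMDiffMap_zero_one_of_isClosed (n := (⊤ : ℕ∞))
      (modelWithCornersSelf ℝ (Vec d)) (s := (interior L)ᶜ)
      (t := F n ∩ Metric.closedBall 0 (n : ℝ)) isOpen_interior.isClosed_compl hK.isClosed
      (Set.disjoint_compl_left_iff_subset.2 hKL)
    have hsupp : Function.support φ ⊆ L := fun x hx => by
      by_contra hxL
      exact hx (h0 fun h => hxL (interior_subset h))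
    have hts : tsupport φ ⊆ L := closure_minimal hsupp hL.isClosed
    refine ⟨φ, φ.contMDiff.contDiff, HasCompactSupport.of_support_subset_isCompact hL hsupp,
      hts.trans hLW, fun x => ?_, fun x hx => h1 hx⟩
    rw [abs_of_nonneg (h01 x).1]
    exact (h01 x).2
  choose φ h1 h2 h3 h4 h5 using key
  refine ⟨φ, h1, h2, h3, h4, fun x => ?_⟩
  by_cases hx : x ∈ W
  · rw [Set.indicator_of_mem hx]
    refine tendsto_const_nhds.congr' ?_
    obtain ⟨m, hm⟩ := Set.mem_iUnion.1 (hFU.symm ▸ hx : x ∈ ⋃ n, F n)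
    obtain ⟨k, hk⟩ := exists_nat_ge ‖x‖
    filter_upwards [eventually_ge_atTop (max m k)] with n hn
    refine (h5 n x ⟨hFm (le_trans (le_max_left _ _) hn) hm, ?_⟩).symm
    rw [mem_closedBall_zero_iff]
    exact hk.trans (by exact_mod_cast le_trans (le_max_right _ _) hn)
  · rw [Set.indicator_of_notMem hx]
    refine tendsto_const_nhds.congr fun n => ?_
    exact (image_eq_zero_of_notMem_tsupport fun h => hx (h3 n h)).symm

/-- The symmetrized derivative is unique. -/
theorem IsSymDeriv.unique {Ω : Set (Vec d)} (hΩ : IsOpen Ω)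
    {u : Lp (Vec d) 1 (volume.restrict Ω)} {μ ν : VectorMeasure (Vec d) (SymMat d)}
    (hμ : IsSymDeriv Ω u μ) (hν : IsSymDeriv Ω u ν) : μ = ν := by
  have hopen : ∀ U : Set (Vec d), IsOpen U → μ U = ν U := by
    intro U hU
    have hW : IsOpen (U ∩ Ω) := hU.inter hΩ
    have hdiff : ∀ ρ : VectorMeasure (Vec d) (SymMat d), ρ.variation Ωᶜ = 0 →
        ρ U = ρ (U ∩ Ω) := by
      intro ρ hρ
      have hd : ρ (U \ (U ∩ Ω)) = 0 := by
        have h : ρ.variation (U \ (U ∩ Ω)) = 0 :=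
          measure_mono_null (fun x hx hxΩ => hx.2 ⟨hx.1, hxΩ⟩) hρ
        have h2 := VectorMeasure.enorm_measure_le_variation ρ (U \ (U ∩ Ω))
        rw [h] at h2
        simpa using h2
      have h3 := VectorMeasure.of_add_of_sdiff (v := ρ) hW.measurableSet hU.measurableSet
        Set.inter_subset_left
      rw [hd, add_zero] at h3
      exact h3.symm
    obtain ⟨φ, h1, h2, h3, h4, h5⟩ := exists_cutoff hW
    have hlim : ∀ ρ : VectorMeasure (Vec d) (SymMat d), IsFiniteMeasure ρ.variation →
        Tendsto (fun n => ∫ᵛ x, φ n x ∂•ρ) atTop (𝓝 (ρ (U ∩ Ω))) := by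
      intro ρ hρ
      have h := VectorMeasure.tendsto_integral_filter_of_norm_le_const (μ := ρ)
        (B := ContinuousLinearMap.lsmul ℝ ℝ) (l := atTop)
        (f := (U ∩ Ω).indicator fun _ => (1 : ℝ))
        (Eventually.of_forall fun n => (h1 n).continuous.aestronglyMeasurable)
        ⟨1, Eventually.of_forall fun n => Eventually.of_forall fun x => h4 n x⟩
        (Eventually.of_forall h5)
      rw [VectorMeasure.integral_indicator_const _ hW.measurableSet] at h
      simpa using h
    have heq : ∀ n, ∫ᵛ x, φ n x ∂•μ = ∫ᵛ x, φ n x ∂•ν := by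
      intro n
      have h3' := (h3 n).trans Set.inter_subset_right
      refine Subtype.ext (PiLp.ext fun p => ?_)
      exact neg_injective ((hμ.integral_eq (φ n) (h1 n) (h2 n) h3' p.1 p.2).symm.trans
        (hν.integral_eq (φ n) (h1 n) (h2 n) h3' p.1 p.2))
    rw [hdiff μ hμ.carried, hdiff ν hν.carried]
    refine tendsto_nhds_unique (hlim μ hμ.finite) ?_
    simpa only [heq] using hlim ν hν.finite
  refine VectorMeasure.ext_of_generateFrom {U | IsOpen U} hopen ?_ isPiSystem_isOpen
    (hopen _ isOpen_univ)
  exact BorelSpace.measurable_eq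

/-- The space `BD(Ω)` of functions of bounded deformation (as classes modulo a.e. equality). -/
def BD (Ω : Set (Vec d)) : Type :=
  {u : Lp (Vec d) 1 (volume.restrict Ω) // ∃ μ, IsSymDeriv Ω u μ}

namespace BD

variable {Ω : Set (Vec d)}

/-- The measure `Eu` (the only measure as in `IsSymDeriv`, see `IsSymDeriv.unique`). -/
def symDeriv (u : BD Ω) : VectorMeasure (Vec d) (SymMat d) := u.2.choose

/-- The density `𝓔u` of the absolutely continuous part of `Eu`. -/
def approxSymGrad (u : BD Ω) : Vec d → SymMat d := density u.symDeriv volume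

/-- The singular part `Eˢu` of `Eu` with respect to Lebesgue measure. -/
def singularDeriv (u : BD Ω) : VectorMeasure (Vec d) (SymMat d) := singularPart u.symDeriv volume

/-- `u ∈ LD(Ω)`, i.e. `Eˢu = 0`. -/
def IsLD (u : BD Ω) : Prop := u.singularDeriv = 0

/-- `⟨·⟩`-strict convergence in `BD(Ω)`: strong convergence in `L¹`, weak* convergence of `Eu_j`
to `Eu` (tested with the functions in `C₀(Ω)`, extended by zero to `ℝ^d`), and
`⟨Eu_j⟩(Ω) → ⟨Eu⟩(Ω)`. -/
structure StrictTendsto (v : ℕ → BD Ω) (u : BD Ω) : Prop where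
  strong : Tendsto (fun k => (v k).1) atTop (𝓝 u.1)
  weakStar : ∀ ψ : ZeroAtInftyContinuousMap (Vec d) ℝ, (∀ x ∉ Ω, ψ x = 0) →
    Tendsto (fun k => ∫ᵛ x, ψ x ∂•(v k).symDeriv) atTop (𝓝 (∫ᵛ x, ψ x ∂•u.symDeriv))
  area : Tendsto (fun k => area Ω (v k).symDeriv) atTop (𝓝 (area Ω u.symDeriv))

/-- Continuity of a functional on `BD(Ω)` with respect to `⟨·⟩`-strict convergence. -/
def StrictlyContinuous (G : BD Ω → ℝ) : Prop :=
  ∀ (v : ℕ → BD Ω) (u : BD Ω), StrictTendsto v u → Tendsto (fun k => G (v k)) atTop (𝓝 (G u))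

/-- `G` is the `⟨·⟩`-strictly continuous extension to `BD(Ω)` of the functional `F` on `LD(Ω)`:
it extends `F`, is strictly continuous, and is the only functional with these properties. -/
structure IsStrictExtension (F : {u : BD Ω // u.IsLD} → ℝ) (G : BD Ω → ℝ) : Prop where
  extends_eq : ∀ u : {u : BD Ω // u.IsLD}, G u.1 = F u
  continuous : StrictlyContinuous G
  unique : ∀ H : BD Ω → ℝ, (∀ u : {u : BD Ω // u.IsLD}, H u.1 = F u) →
    StrictlyContinuous H → H = G

end BD

/-- The class `𝐄(Ω; ℝ^{d×d}_sym)`: `f` is continuous on `Ω × ℝ^{d×d}_sym`, and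
`(Sf)(x, A) = (1 - |A|) f(x, A / (1 - |A|))` extends to a bounded continuous function on the closure
of `Ω × 𝔹`, with `𝔹` the open unit ball of `ℝ^{d×d}_sym`. Values `f x A` with `x ∉ Ω` are
irrelevant. -/
structure IsIntegrand (Ω : Set (Vec d)) (f : Vec d → SymMat d → ℝ) : Prop where
  continuousOn : ContinuousOn (fun p : Vec d × SymMat d => f p.1 p.2) (Ω ×ˢ Set.univ)
  extension : ∃ g : Vec d × SymMat d → ℝ,
    ContinuousOn g (closure (Ω ×ˢ Metric.ball (0 : SymMat d) 1)) ∧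
    (∃ C : ℝ, ∀ p ∈ closure (Ω ×ˢ Metric.ball (0 : SymMat d) 1), |g p| ≤ C) ∧
    ∀ x ∈ Ω, ∀ A ∈ Metric.ball (0 : SymMat d) 1,
      g (x, A) = (1 - ‖A‖) * f x ((1 - ‖A‖)⁻¹ • A)

/-- `f(x', tA')/t → l` as `Ω ∋ x' → x`, `A' → A`, `t → ∞`. -/
def HasRecession (Ω : Set (Vec d)) (f : Vec d → SymMat d → ℝ) (x : Vec d) (A : SymMat d)
    (l : ℝ) : Prop :=
  Tendsto (fun p : Vec d × SymMat d × ℝ => f p.1 (p.2.2 • p.2.1) / p.2.2)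
    (𝓝[Ω] x ×ˢ 𝓝 A ×ˢ atTop) (𝓝 l)

/-- The recession function `f^∞(x, A) = lim f(x', tA')/t`. -/
def recession (Ω : Set (Vec d)) (f : Vec d → SymMat d → ℝ) (x : Vec d) (A : SymMat d) : ℝ :=
  limUnder (𝓝[Ω] x ×ˢ 𝓝 A ×ˢ atTop)
    (fun p : Vec d × SymMat d × ℝ => f p.1 (p.2.2 • p.2.1) / p.2.2)

end BoundedDeformation

end

/-! The pair `(dx, Eu)` is a measure on `Ω` with values in `ℝ × ℝ^{d×d}_sym`. Its total variation is
`√(1 + |𝓔u|²) dx + |Eˢu|` (`liftMeasure`), its polar field is `liftField`, and its total mass is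
`area`. Let `h(x, (t, A))` be the positively 1-homogeneous perspective of `f`, with `h(x, (1, A)) =
f(x, A)`. The extension of `Sf` to the closure makes `h` continuous up to `t = 0`, where homogeneity
gives `h(x, (0, A)) = f^∞(x, A)`. The functional with its recession term is therefore a single
integral of `h` along the polar field of `(dx, Eu)` (`BD.integral_recession`).

Continuity. Under `⟨·⟩`-strict convergence the lifted measures converge weakly* and so do their
masses, which is the setting of Reshetnyak's theorem (`StrictConvergence.tendsto_integral_comp`).
Its proof picks a compactly supported continuous field `φ` in the unit ball for which the defect `∫
(1 - ⟨φ, ν⟩)` of the limit is small. The defect is mass minus pairing, so it stays small along the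
sequence; it also dominates `∫ |ν_j - φ|² / 2`, so the polar fields may be replaced by the fixed
field `φ`.

Uniqueness. It suffices that `LD(Ω)` is strictly dense (`BD.exists_isLD_strictTendsto`), by a
construction in the manner of Meyers and Serrin. With a partition of unity `φ_k` and mollifiers
`ρ_k`, put `v = u + Σ (ρ_k * (φ_k u) - φ_k u)`. Then `Ev = Σ (ρ_k * (φ_k Eu) + ρ_k * (u ⊙ ∇φ_k) - u
⊙ ∇φ_k)`, a series which converges absolutely in `L¹`, so local finiteness of the partition is not
needed. Treating `dx` in the same way, with `-φ_k` in the role of `u ⊙ ∇φ_k`, the first coordinate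
of the `k`-th term is exactly `φ_k`. So on `Ω` the field `(1, 𝓔v)` is a sum of fields whose `L¹`
norms are at most the lifted mass of `φ_k` plus a small error, and the area of `v` exceeds that of
`u` by at most `δ`. The opposite inequality in the limit is weak* lower semicontinuity
(`eventually_lt_area`). -/

noncomputable section

namespace BoundedDeformation

variable {d : ℕ}

/-! ### Lebesgue and polar decompositions of vector measures -/

section VectorMeasures

variable {X V : Type*} [MeasurableSpace X] [NormedAddCommGroup V]

/-- Integration of a bounded scalar function against a vector measure with an integrable
density. -/
theorem integral_withDensityᵥ_smul [NormedSpace ℝ V] [CompleteSpace V] {m : Measure X} {g : X → V}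
    (hg : Integrable g m) {ψ : X → ℝ} (hψ : StronglyMeasurable ψ) {C : ℝ} (hC : ∀ x, ‖ψ x‖ ≤ C) :
    ∫ᵛ x, ψ x ∂•(m.withDensityᵥ g) = ∫ x, ψ x • g x ∂m := by
  have : IsFiniteMeasure (m.withDensityᵥ g).variation := by
    rw [Measure.variation_withDensityᵥ hg]; exact isFiniteMeasure_withDensity hg.2.ne
  have hsimple : ∀ s : SimpleFunc X ℝ,
      ∫ᵛ x, s x ∂•(m.withDensityᵥ g) = ∫ x, s x • g x ∂m := by
    intro s
    induction s using SimpleFunc.induction with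
    | @const c s hs =>
      have h1 : ⇑(SimpleFunc.piecewise s hs (SimpleFunc.const X c) (SimpleFunc.const X 0))
          = s.indicator fun _ => c := by
        ext x; simp [Set.indicator, Set.piecewise]
      simp only [h1]
      rw [VectorMeasure.integral_indicator_const _ hs, withDensityᵥ_apply hg hs]
      simp only [ContinuousLinearMap.lsmul_apply, ← Set.indicator_smul_left]
      rw [integral_indicator hs, integral_smul]
    | @add s t hd hs ht =>
      have hb : ∀ s : SimpleFunc X ℝ, (m.withDensityᵥ g).Integrable s := fun s =>
        SimpleFunc.integrable_of_isFiniteMeasure s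
      have hb' : ∀ s : SimpleFunc X ℝ, Integrable (fun x => s x • g x) m := fun s => by
        obtain ⟨C, hC⟩ := s.exists_forall_norm_le
        exact hg.bdd_smul C s.aestronglyMeasurable (Eventually.of_forall hC)
      rw [SimpleFunc.coe_add, VectorMeasure.integral_add (hb s) (hb t), hs, ht,
        ← integral_add (hb' s) (hb' t)]
      simp [add_smul]
  have h1 := VectorMeasure.tendsto_integral_filter_of_norm_le_const (μ := m.withDensityᵥ g)
    (B := ContinuousLinearMap.lsmul ℝ ℝ) (l := atTop) (f := ψ)
    (Eventually.of_forall fun n => (hψ.approxBounded C n).aestronglyMeasurable)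
    ⟨C, Eventually.of_forall fun n => Eventually.of_forall fun x =>
      hψ.norm_approxBounded_le ((norm_nonneg _).trans (hC x)) n x⟩
    (Eventually.of_forall fun x => hψ.tendsto_approxBounded_of_norm_le (hC x))
  refine tendsto_nhds_unique h1 ?_
  simp only [hsimple]
  refine tendsto_integral_of_dominated_convergence (fun x => C * ‖g x‖)
    (fun n => (hψ.approxBounded C n).aestronglyMeasurable.smul hg.aestronglyMeasurable)
    (hg.norm.const_mul C) (fun n => Eventually.of_forall fun x => ?_)
    (Eventually.of_forall fun x => (hψ.tendsto_approxBounded_of_norm_le (hC x)).smul_const _)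
  rw [norm_smul]
  gcongr
  exact hψ.norm_approxBounded_le ((norm_nonneg _).trans (hC x)) n x

variable [InnerProductSpace ℝ V] [FiniteDimensional ℝ V]

theorem component_apply (μ : VectorMeasure X V) (i : Fin (Module.finrank ℝ V)) (s : Set X) :
    component μ i s = inner ℝ (stdOrthonormalBasis ℝ V i) (μ s) := rfl

theorem sum_component_smul (μ : VectorMeasure X V) (s : Set X) :
    ∑ i, component μ i s • stdOrthonormalBasis ℝ V i = μ s := by
  simp only [component_apply]
  exact (stdOrthonormalBasis ℝ V).sum_repr' (μ s)

theorem setIntegral_density (μ : VectorMeasure X V) (ν : Measure X) {s : Set X}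
    (hs : MeasurableSet s) :
    ∫ x in s, density μ ν x ∂ν
      = ∑ i, ν.withDensityᵥ ((component μ i).rnDeriv ν) s • stdOrthonormalBasis ℝ V i := by
  unfold density
  rw [integral_finsetSum _ fun i _ =>
    ((SignedMeasure.integrable_rnDeriv (component μ i) ν).smul_const _).integrableOn]
  refine Finset.sum_congr rfl fun i _ => ?_
  rw [integral_smul_const, withDensityᵥ_apply (SignedMeasure.integrable_rnDeriv _ _) hs]

/-- The singular part is the restriction of the measure to a null set. -/
theorem exists_singularPart_eq_restrict (μ : VectorMeasure X V) (ν : Measure X) [SigmaFinite ν] :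
    ∃ N, MeasurableSet N ∧ ν N = 0 ∧ singularPart μ ν = μ.restrict N ∧
      ν.withDensityᵥ (density μ ν) = μ.restrict Nᶜ := by
  -- Each component yields a set `S i` on which its singular part vanishes and whose complement is
  -- `ν`-null. The union of the complements is still null and carries the singular parts of all
  -- components at once.
  have hms := fun i => (component μ i).mutuallySingular_singularPart ν
  choose S hS h1 h2 using hms
  have hN : MeasurableSet (⋃ i, (S i)ᶜ) := MeasurableSet.iUnion fun i => (hS i).compl
  have hnull : ν (⋃ i, (S i)ᶜ) = 0 := by
    refine measure_iUnion_null fun i => ?_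
    have := h2 i _ subset_rfl
    rwa [Measure.toENNRealVectorMeasure_apply_measurable (hS i).compl] at this
  have hac : ∀ s, MeasurableSet s → s ⊆ ⋂ i, S i → ν.withDensityᵥ (density μ ν) s = μ s := by
    intro s hs hsub
    rw [withDensityᵥ_apply (integrable_density μ ν) hs, setIntegral_density μ ν hs,
      ← sum_component_smul μ s]
    refine Finset.sum_congr rfl fun i _ => ?_
    congr 1
    conv_rhs => rw [← (component μ i).singularPart_add_withDensity_rnDeriv_eq (μ := ν)]
    rw [_root_.add_apply, h1 i s (hsub.trans (Set.iInter_subset _ i)), zero_add]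
  have hzero : ∀ s, MeasurableSet s → ν.withDensityᵥ (density μ ν) (s ∩ ⋃ i, (S i)ᶜ) = 0 := by
    intro s hs
    rw [withDensityᵥ_apply (integrable_density μ ν) (hs.inter hN)]
    exact setIntegral_measure_zero _ (measure_mono_null Set.inter_subset_right hnull)
  have hcompl : (⋃ i, (S i)ᶜ)ᶜ = ⋂ i, S i := by simp
  have hw : ν.withDensityᵥ (density μ ν) = μ.restrict (⋃ i, (S i)ᶜ)ᶜ := by
    ext1 s hs
    rw [VectorMeasure.restrict_apply _ hN.compl hs]
    have h := VectorMeasure.of_add_of_sdiff (v := ν.withDensityᵥ (density μ ν))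
      (hs.inter hN) hs Set.inter_subset_left
    rw [hzero s hs, zero_add, Set.sdiff_self_inter, Set.sdiff_eq] at h
    rw [← h, hac _ (hs.inter hN.compl) (by rw [hcompl]; exact Set.inter_subset_right)]
  refine ⟨_, hN, hnull, ?_, hw⟩
  rw [singularPart, hw, sub_eq_iff_eq_add]
  exact (VectorMeasure.restrict_add_restrict_compl hN).symm

theorem withDensityᵥ_density_add_singularPart (μ : VectorMeasure X V) (ν : Measure X) :
    ν.withDensityᵥ (density μ ν) + singularPart μ ν = μ := by
  simp [singularPart]

/-- The polar decomposition of a vector measure. -/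
theorem withDensityᵥ_density_variation (μ : VectorMeasure X V) [IsFiniteMeasure μ.variation] :
    μ.variation.withDensityᵥ (density μ μ.variation) = μ := by
  obtain ⟨N, hN, h0, h1, h2⟩ := exists_singularPart_eq_restrict μ μ.variation
  have h3 := withDensityᵥ_density_add_singularPart μ μ.variation
  -- Here the reference measure is `μ.variation` itself, so the null set carrying the singular part
  -- is null for `μ` too.
  have : μ.restrict N = 0 := by
    rw [← VectorMeasure.variation_eq_zero, VectorMeasure.variation_restrict hN,
      Measure.restrict_eq_zero, h0]
  rwa [h1, this, add_zero] at h3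

/-- Taking variations in the polar decomposition gives `|μ| = ‖density‖ |μ|`, and densities with
respect to a finite measure are unique. -/
theorem norm_density_variation (μ : VectorMeasure X V) [IsFiniteMeasure μ.variation] :
    ∀ᵐ x ∂μ.variation, ‖density μ μ.variation x‖ = 1 := by
  have h := Measure.variation_withDensityᵥ (integrable_density μ μ.variation)
  rw [withDensityᵥ_density_variation] at h
  have h1 : μ.variation.withDensity (fun _ => 1) = μ.variation := withDensity_one
  have h2 := (withDensity_eq_iff_of_sigmaFinite aemeasurable_const
    (integrable_density μ μ.variation).aestronglyMeasurable.enorm).1 (h1.trans h)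
  filter_upwards [h2] with x hx
  rw [← toReal_enorm, ← hx, ENNReal.toReal_one]

/-- The singular part is a restriction to a `ν`-null set, where the variation `‖e‖ ν` has no mass;
uniqueness of densities then identifies `e`. -/
theorem density_withDensityᵥ {ν : Measure X} [SigmaFinite ν] {e : X → V} (he : Integrable e ν) :
    density (ν.withDensityᵥ e) ν =ᵐ[ν] e ∧ singularPart (ν.withDensityᵥ e) ν = 0 := by
  obtain ⟨N, hN, h0, h1, h2⟩ := exists_singularPart_eq_restrict (ν.withDensityᵥ e) ν
  have h3 := withDensityᵥ_density_add_singularPart (ν.withDensityᵥ e) ν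
  have hs : singularPart (ν.withDensityᵥ e) ν = 0 := by
    rw [h1, ← VectorMeasure.variation_eq_zero, VectorMeasure.variation_restrict hN,
      Measure.restrict_eq_zero, Measure.variation_withDensityᵥ he]
    exact withDensity_absolutelyContinuous _ _ h0
  rw [hs, add_zero] at h3
  exact ⟨(integrable_density _ _).ae_eq_of_withDensityᵥ_eq he h3, hs⟩

end VectorMeasures


/-! ### The homogeneous perspective of an integrand and its recession function -/

/-- The space `ℝ × ℝ^{d×d}_sym` with the Euclidean norm. -/
abbrev LiftVec (d : ℕ) : Type := WithLp 2 (ℝ × SymMat d)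

theorem LiftVec.fst_add_norm_snd_le (z : LiftVec d) : max z.fst 0 + ‖z.snd‖ ≤ 2 * ‖z‖ := by
  have h1 : |z.fst| ≤ ‖z‖ := WithLp.norm_fst_le _ z
  have h2 : ‖z.snd‖ ≤ ‖z‖ := WithLp.norm_snd_le _ z
  have h3 : max z.fst 0 ≤ |z.fst| := max_le (le_abs_self _) (abs_nonneg _)
  linarith

/-- The positively `1`-homogeneous function on `ℝ × ℝ^{d×d}_sym` with the values
`(t + |A|) g(A / (t + |A|))` for `t ≥ 0`. -/
def homogenize (g : Vec d × SymMat d → ℝ) (p : Vec d × LiftVec d) : ℝ :=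
  (max p.2.fst 0 + ‖p.2.snd‖) * g (p.1, (max p.2.fst 0 + ‖p.2.snd‖)⁻¹ • p.2.snd)

section Homogenize

variable {T : Set (Vec d)} {g : Vec d × SymMat d → ℝ} {C : ℝ}

theorem homogenize_mem {x : Vec d} (hx : x ∈ T) (z : LiftVec d) :
    (x, (max z.fst 0 + ‖z.snd‖)⁻¹ • z.snd) ∈ T ×ˢ Metric.closedBall (0 : SymMat d) 1 := by
  refine ⟨hx, ?_⟩
  have h0 : 0 ≤ max z.fst 0 := le_max_right _ _
  rw [mem_closedBall_zero_iff, norm_smul, norm_inv, Real.norm_of_nonneg (by positivity)]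
  exact inv_mul_le_one_of_le₀ (by linarith) (by positivity)

theorem abs_homogenize_le' (hC : ∀ p ∈ T ×ˢ Metric.closedBall (0 : SymMat d) 1, |g p| ≤ C)
    {x : Vec d} (hx : x ∈ T) (z : LiftVec d) :
    |homogenize g (x, z)| ≤ (max z.fst 0 + ‖z.snd‖) * C := by
  have h0 : 0 ≤ max z.fst 0 := le_max_right _ _
  rw [homogenize, abs_mul, abs_of_nonneg (by positivity)]
  gcongr
  exact hC _ (homogenize_mem hx z)

theorem abs_homogenize_le (hC : ∀ p ∈ T ×ˢ Metric.closedBall (0 : SymMat d) 1, |g p| ≤ C)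
    {x : Vec d} (hx : x ∈ T) (z : LiftVec d) : |homogenize g (x, z)| ≤ 2 * C * ‖z‖ := by
  have h0 : 0 ≤ C := (abs_nonneg _).trans (hC (x, 0) ⟨hx, by simp⟩)
  calc _ ≤ _ := abs_homogenize_le' hC hx z
    _ ≤ 2 * ‖z‖ * C := by gcongr; exact z.fst_add_norm_snd_le
    _ = _ := by ring

theorem homogenize_smul (x : Vec d) (z : LiftVec d) {c : ℝ} (hc : 0 < c) :
    homogenize g (x, c • z) = c * homogenize g (x, z) := by
  have h1 : max (c * z.fst) 0 + c * ‖z.snd‖ = c * (max z.fst 0 + ‖z.snd‖) := by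
    rw [mul_add, mul_max_of_nonneg _ _ hc.le, mul_zero]
  have h2 : ∀ r : ℝ, (c * r)⁻¹ * c = r⁻¹ := fun r => by
    rw [mul_inv, mul_right_comm, inv_mul_cancel₀ hc.ne', one_mul]
  simp only [homogenize, WithLp.smul_fst, WithLp.smul_snd, norm_smul, Real.norm_of_nonneg hc.le,
    smul_eq_mul, h1, smul_smul, h2, mul_assoc]

theorem continuousOn_homogenize (hg : ContinuousOn g (T ×ˢ Metric.closedBall 0 1))
    (hC : ∀ p ∈ T ×ˢ Metric.closedBall (0 : SymMat d) 1, |g p| ≤ C) :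
    ContinuousOn (homogenize g) (T ×ˢ Set.univ) := by
  have hr : Continuous fun p : Vec d × LiftVec d => max p.2.fst 0 + ‖p.2.snd‖ := by fun_prop
  rintro ⟨x, z⟩ ⟨hx, -⟩
  -- Where the radius vanishes the rescaled argument of `g` has no limit, but `g` is bounded and the
  -- prefactor tends to zero.
  by_cases h0 : max z.fst 0 + ‖z.snd‖ = 0
  · have hz : homogenize g (x, z) = 0 := by simp [homogenize, h0]
    rw [ContinuousWithinAt, hz]
    refine squeeze_zero_norm' (a := fun p : Vec d × LiftVec d =>
      (max p.2.fst 0 + ‖p.2.snd‖) * C) ?_ ?_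
    · filter_upwards [self_mem_nhdsWithin] with p hp
      exact abs_homogenize_le' hC hp.1 p.2
    · have h := (hr.mul_const C).tendsto (x, z)
      simp only [h0, zero_mul] at h
      exact h.mono_left nhdsWithin_le_nhds
  · refine hr.continuousWithinAt.mul ?_
    refine (hg _ (homogenize_mem hx z)).comp
      (f := fun p : Vec d × LiftVec d => (p.1, (max p.2.fst 0 + ‖p.2.snd‖)⁻¹ • p.2.snd)) ?_
      (fun p hp => homogenize_mem hp.1 p.2)
    refine ContinuousAt.continuousWithinAt ?_
    refine continuousAt_fst.prodMk ((hr.continuousAt.inv₀ h0).smul ?_)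
    fun_prop

end Homogenize

variable {Ω : Set (Vec d)} {f : Vec d → SymMat d → ℝ}

/-- Perspective function of an integrand of class `𝐄`: a positively `1`-homogeneous function
`h(x, (t, A))` which is continuous up to `t = 0`. -/
theorem IsIntegrand.exists_perspective (hf : IsIntegrand Ω f) :
    ∃ (h : Vec d × LiftVec d → ℝ) (C : ℝ), 0 ≤ C ∧ ContinuousOn h (closure Ω ×ˢ Set.univ) ∧
      (∀ x ∈ closure Ω, ∀ z, |h (x, z)| ≤ C * ‖z‖) ∧
      (∀ x z, ∀ c : ℝ, 0 < c → h (x, c • z) = c * h (x, z)) ∧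
      ∀ x ∈ Ω, ∀ A, h (x, WithLp.toLp 2 (1, A)) = f x A := by
  obtain ⟨g, hg, ⟨C, hC⟩, hgf⟩ := hf.extension
  rw [closure_prod_eq, closure_ball _ one_ne_zero] at hg hC
  -- The factor 2 compares `t + |A|` with the Euclidean norm of `(t, A)`. The maximum with 0 is
  -- needed because a bound over an empty set may be negative.
  refine ⟨homogenize g, 2 * max C 0, by positivity, continuousOn_homogenize hg hC,
    fun x hx z => (abs_homogenize_le (fun p hp => (hC p hp).trans (le_max_left C 0)) hx z),
    fun x z c hc => homogenize_smul x z hc, fun x hx A => ?_⟩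
  have h1 : 0 < 1 + ‖A‖ := by positivity
  have hA : ‖(1 + ‖A‖)⁻¹ • A‖ = ‖A‖ / (1 + ‖A‖) := by
    rw [norm_smul, norm_inv, Real.norm_of_nonneg h1.le]; ring
  have h2 : 1 - ‖(1 + ‖A‖)⁻¹ • A‖ = (1 + ‖A‖)⁻¹ := by rw [hA]; field_simp; ring
  -- The map `A ↦ A / (1 + |A|)` is inverse to `A ↦ A / (1 - |A|)`, so `f` is recovered from `g` on
  -- the open ball.
  have hmem : (1 + ‖A‖)⁻¹ • A ∈ Metric.ball (0 : SymMat d) 1 := by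
    rw [mem_ball_zero_iff, hA, div_lt_one h1]; linarith
  simp only [homogenize, WithLp.toLp_fst, WithLp.toLp_snd, max_eq_left zero_le_one]
  rw [hgf x hx _ hmem, h2, inv_inv, smul_smul, mul_inv_cancel₀ h1.ne', one_smul,
    mul_inv_cancel_left₀ h1.ne']

/-- By homogeneity `f(x', tA') / t = h(x', (1/t, A'))`, and the argument tends to `(x, (0, A))`,
where `h` is continuous. -/
theorem hasRecession_of_perspective {h : Vec d × LiftVec d → ℝ}
    (hcont : ContinuousOn h (closure Ω ×ˢ Set.univ))
    (hsmul : ∀ x z, ∀ c : ℝ, 0 < c → h (x, c • z) = c * h (x, z))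
    (hf : ∀ x ∈ Ω, ∀ A, h (x, WithLp.toLp 2 (1, A)) = f x A) {x : Vec d} (hx : x ∈ closure Ω)
    (A : SymMat d) : HasRecession Ω f x A (h (x, WithLp.toLp 2 (0, A))) := by
  have hlim : Tendsto (fun p : Vec d × SymMat d × ℝ =>
      (p.1, (WithLp.toLp 2 (p.2.2⁻¹, p.2.1) : LiftVec d))) (𝓝[Ω] x ×ˢ 𝓝 A ×ˢ atTop)
      (𝓝[closure Ω ×ˢ Set.univ] (x, WithLp.toLp 2 (0, A))) := by
    refine tendsto_nhdsWithin_iff.2 ⟨?_, ?_⟩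
    · refine Tendsto.prodMk_nhds (tendsto_fst.mono_right nhdsWithin_le_nhds) ?_
      refine ((WithLp.prod_continuous_toLp 2 ℝ (SymMat d)).tendsto (0, A)).comp ?_
      exact Tendsto.prodMk_nhds (tendsto_inv_atTop_zero.comp (tendsto_snd.comp tendsto_snd))
        (tendsto_fst.comp tendsto_snd)
    · have : ∀ᶠ y in 𝓝[Ω] x, y ∈ Ω := self_mem_nhdsWithin
      filter_upwards [this.prod_inl _] with p hp
      exact ⟨subset_closure hp, trivial⟩
  refine ((hcont _ ⟨hx, trivial⟩).tendsto.comp hlim).congr' ?_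
  have h1 : ∀ᶠ y in 𝓝[Ω] x, y ∈ Ω := self_mem_nhdsWithin
  have h2 := ((eventually_gt_atTop (0 : ℝ)).prod_inr (𝓝 A)).prod_inr (𝓝[Ω] x)
  filter_upwards [h1.prod_inl _, h2] with p hp hp2
  have h3 : (WithLp.toLp 2 (p.2.2⁻¹, p.2.1) : LiftVec d)
      = p.2.2⁻¹ • WithLp.toLp 2 (1, p.2.2 • p.2.1) := by
    rw [← WithLp.toLp_smul, Prod.smul_mk, smul_smul, inv_mul_cancel₀ hp2.ne', one_smul,
      smul_eq_mul, mul_one]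
  simp only [Function.comp_apply]
  rw [h3, hsmul _ _ _ (inv_pos.2 hp2), hf _ hp, div_eq_inv_mul]

theorem recession_eq_of_perspective {h : Vec d × LiftVec d → ℝ}
    (hcont : ContinuousOn h (closure Ω ×ˢ Set.univ))
    (hsmul : ∀ x z, ∀ c : ℝ, 0 < c → h (x, c • z) = c * h (x, z))
    (hf : ∀ x ∈ Ω, ∀ A, h (x, WithLp.toLp 2 (1, A)) = f x A) {x : Vec d} (hx : x ∈ closure Ω)
    (A : SymMat d) : recession Ω f x A = h (x, WithLp.toLp 2 (0, A)) := by
  have : (𝓝[Ω] x).NeBot := mem_closure_iff_nhdsWithin_neBot.1 hx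
  exact (hasRecession_of_perspective hcont hsmul hf hx A).limUnder_eq


/-! ### Reshetnyak's continuity theorem -/

section Reshetnyak

variable {V : Type*} [NormedAddCommGroup V] [InnerProductSpace ℝ V]

/-- Converts the defect `1 - ⟨φ, ν⟩`, which is controlled by mass and pairing alone, into a bound on
`|ν - φ|²`. -/
theorem norm_sub_sq_le_of_norm_le_one {a b : V} (ha : ‖a‖ ≤ 1) (hb : ‖b‖ ≤ 1) :
    ‖a - b‖ ^ 2 ≤ 2 * (1 - inner ℝ b a) := by
  rw [norm_sub_sq_real, real_inner_comm]
  nlinarith [norm_nonneg a, norm_nonneg b]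

theorem norm_projBall_le (z : V) : ‖(max 1 ‖z‖)⁻¹ • z‖ ≤ 1 := by
  have h0 : 0 < max 1 ‖z‖ := lt_max_of_lt_left one_pos
  rw [norm_smul, norm_inv, Real.norm_of_nonneg h0.le]
  exact inv_mul_le_one_of_le₀ (le_max_right _ _) h0.le

/-- The radial projection moves `z` by its distance to the unit ball, which is at most `|a - z|`;
the triangle inequality does the rest. -/
theorem norm_sub_projBall_le {a : V} (ha : ‖a‖ ≤ 1) (z : V) :
    ‖a - (max 1 ‖z‖)⁻¹ • z‖ ≤ 2 * ‖a - z‖ := by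
  have h0 : 0 < max 1 ‖z‖ := lt_max_of_lt_left one_pos
  have h1 : ‖z - (max 1 ‖z‖)⁻¹ • z‖ ≤ ‖a - z‖ := by
    have h2 : z - (max 1 ‖z‖)⁻¹ • z = (1 - (max 1 ‖z‖)⁻¹) • z := by rw [sub_smul, one_smul]
    have h3 : (max 1 ‖z‖)⁻¹ ≤ 1 := inv_le_one_of_one_le₀ (le_max_left _ _)
    rw [h2, norm_smul, Real.norm_of_nonneg (by linarith)]
    rcases le_total ‖z‖ 1 with h | h
    · rw [max_eq_left h]; simp
    · have h4 : ‖z‖ ≠ 0 := by linarith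
      rw [max_eq_right h, sub_mul, inv_mul_cancel₀ h4, one_mul]
      have := norm_sub_norm_le z a
      rw [norm_sub_rev z a] at this
      linarith
  calc ‖a - (max 1 ‖z‖)⁻¹ • z‖ = ‖(a - z) + (z - (max 1 ‖z‖)⁻¹ • z)‖ := by congr 1; abel
    _ ≤ _ := by linarith [norm_add_le (a - z) (z - (max 1 ‖z‖)⁻¹ • z)]

/-- A unit vector field is approximated by compactly supported continuous fields in the unit
ball. -/
theorem exists_test_field {Ω : Set (Vec d)} (hΩ : IsOpen Ω) {m : Measure (Vec d)}
    [IsFiniteMeasure m] (hm : m Ωᶜ = 0) {ν : Vec d → V} (hν : AEStronglyMeasurable ν m)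
    (h1 : ∀ᵐ x ∂m, ‖ν x‖ = 1) {η : ℝ} (hη : 0 < η) :
    ∃ φ : Vec d → V, Continuous φ ∧ HasCompactSupport φ ∧ tsupport φ ⊆ Ω ∧ (∀ x, ‖φ x‖ ≤ 1) ∧
      ∫ x, (1 - inner ℝ (φ x) (ν x)) ∂m < η := by
  have hint : Integrable ν m := Integrable.of_bound hν 1 (h1.mono fun x hx => hx.le)
  -- The projection to the unit ball doubles the error `η / 4`, leaving `η / 2` for the cut-off.
  obtain ⟨g, -, hg, hgc, hgi⟩ := hint.exists_hasCompactSupport_integral_sub_le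
    (show (0 : ℝ) < η / 4 by positivity)
  obtain ⟨ψ, hψ1, hψ2, hψ3, hψ4, hψ5⟩ := exists_cutoff hΩ
  set p : Vec d → V := fun x => (max 1 ‖g x‖)⁻¹ • g x with hp
  have hpc : Continuous p :=
    ((continuous_const.max hgc.norm).inv₀ fun x => (lt_max_of_lt_left one_pos).ne').smul hgc
  have hp1 : ∀ x, ‖p x‖ ≤ 1 := fun x => norm_projBall_le _
  have hle : ∫ x, (1 - inner ℝ (p x) (ν x)) ∂m ≤ η / 2 := by
    calc ∫ x, (1 - inner ℝ (p x) (ν x)) ∂m ≤ ∫ x, 2 * ‖ν x - g x‖ ∂m := by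
          refine integral_mono_ae ((integrable_const _).sub ?_) ((hint.sub hgi).norm.const_mul 2) ?_
          · refine Integrable.of_bound (hpc.aestronglyMeasurable.inner hν) 1 (h1.mono fun x hx => ?_)
            exact (norm_inner_le_norm _ _).trans (by rw [hx, mul_one]; exact hp1 x)
          · filter_upwards [h1] with x hx
            have h2 : 1 - inner ℝ (p x) (ν x) = inner ℝ (ν x - p x) (ν x) := by
              rw [inner_sub_left, real_inner_self_eq_norm_sq, hx, one_pow]
            rw [h2]
            refine (real_inner_le_norm _ _).trans ?_
            rw [hx, mul_one]
            exact norm_sub_projBall_le hx.le _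
      _ ≤ η / 2 := by rw [integral_const_mul]; linarith
  -- The support of `p` is compact but may leave `Ω`. Multiplying by the cut-offs repairs this, and
  -- costs nothing in the limit since `m` is carried by `Ω`.
  have hlim : Tendsto (fun n => ∫ x, (1 - inner ℝ (ψ n x • p x) (ν x)) ∂m) atTop
      (𝓝 (∫ x, (1 - inner ℝ (p x) (ν x)) ∂m)) := by
    refine tendsto_integral_of_dominated_convergence (fun _ => 2) (fun n => ?_)
      (integrable_const _) (fun n => ?_) ?_
    · exact aestronglyMeasurable_const.sub
        (((hψ1 n).continuous.smul hpc).aestronglyMeasurable.inner hν)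
    · filter_upwards [h1] with x hx
      have h3 : ‖inner ℝ (ψ n x • p x) (ν x)‖ ≤ 1 := by
        refine (norm_inner_le_norm _ _).trans ?_
        rw [hx, mul_one, norm_smul]
        exact mul_le_one₀ (hψ4 n x) (norm_nonneg _) (hp1 x)
      calc _ ≤ ‖(1 : ℝ)‖ + ‖inner ℝ (ψ n x • p x) (ν x)‖ := norm_sub_le _ _
        _ ≤ 2 := by rw [norm_one]; linarith
    · filter_upwards [measure_eq_zero_iff_ae_notMem.1 hm] with x hx
      have h4 := hψ5 x
      rw [Set.indicator_of_mem (by simpa using hx)] at h4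
      have h5 := ((h4.smul_const (p x)).inner (𝕜 := ℝ)
        (tendsto_const_nhds (x := ν x))).const_sub (1 : ℝ)
      simpa using h5
  obtain ⟨n, hn⟩ := (hlim.eventually_lt_const (show _ < η by linarith)).exists
  refine ⟨fun x => ψ n x • p x, (hψ1 n).continuous.smul hpc, (hψ2 n).smul_right,
    (tsupport_smul_subset_left _ _).trans (hψ3 n), fun x => ?_, hn⟩
  rw [norm_smul]
  exact mul_le_one₀ (hψ4 n x) (norm_nonneg _) (hp1 x)

/-- Weak* convergence of the vector measures `ν_j λ_j` to `ν λ` on `Ω`, together with convergence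
of the total masses of the `λ_j`, for fields with `|ν_j| ≤ 1` and `|ν| = 1`. -/
structure StrictConvergence (Ω : Set (Vec d)) (l : ℕ → Measure (Vec d)) (ν : ℕ → Vec d → V)
    (m : Measure (Vec d)) (ν₀ : Vec d → V) : Prop where
  isOpen : IsOpen Ω
  finite : ∀ j, IsFiniteMeasure (l j)
  finite_limit : IsFiniteMeasure m
  carried : ∀ j, l j Ωᶜ = 0
  carried_limit : m Ωᶜ = 0
  meas : ∀ j, AEStronglyMeasurable (ν j) (l j)
  meas_limit : AEStronglyMeasurable ν₀ m
  norm_le : ∀ j, ∀ᵐ x ∂(l j), ‖ν j x‖ ≤ 1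
  norm_limit : ∀ᵐ x ∂m, ‖ν₀ x‖ = 1
  weakStar : ∀ φ : Vec d → V, Continuous φ → HasCompactSupport φ → tsupport φ ⊆ Ω →
    Tendsto (fun j => ∫ x, inner ℝ (φ x) (ν j x) ∂(l j)) atTop (𝓝 (∫ x, inner ℝ (φ x) (ν₀ x) ∂m))
  mass : Tendsto (fun j => (l j).real Set.univ) atTop (𝓝 (m.real Set.univ))

namespace StrictConvergence

variable {Ω : Set (Vec d)} {l : ℕ → Measure (Vec d)} {ν : ℕ → Vec d → V}
  {m : Measure (Vec d)} {ν₀ : Vec d → V}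

theorem integrable_inner {l : Measure (Vec d)} [IsFiniteMeasure l] {ν φ : Vec d → V}
    (hν : AEStronglyMeasurable ν l) (h1 : ∀ᵐ x ∂l, ‖ν x‖ ≤ 1) (hφ : Continuous φ)
    (hφ1 : ∀ x, ‖φ x‖ ≤ 1) : Integrable (fun x => inner ℝ (φ x) (ν x)) l := by
  refine Integrable.of_bound (hφ.aestronglyMeasurable.inner hν) 1 (h1.mono fun x hx => ?_)
  exact (norm_inner_le_norm _ _).trans (mul_le_one₀ (hφ1 x) (norm_nonneg _) hx)

/-- For a fixed test field the defect is total mass minus pairing. Both converge, so a defect that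
is small in the limit is small for all late indices. -/
theorem exists_test (H : StrictConvergence Ω l ν m ν₀) {η : ℝ} (hη : 0 < η) :
    ∃ φ : Vec d → V, Continuous φ ∧ HasCompactSupport φ ∧ tsupport φ ⊆ Ω ∧ (∀ x, ‖φ x‖ ≤ 1) ∧
      ∫ x, (1 - inner ℝ (φ x) (ν₀ x)) ∂m < η ∧
      ∀ᶠ j in atTop, ∫ x, (1 - inner ℝ (φ x) (ν j x)) ∂(l j) < η := by
  have := H.finite_limit
  have := H.finite
  obtain ⟨φ, h1, h2, h3, h4, h5⟩ :=
    exists_test_field H.isOpen H.carried_limit H.meas_limit H.norm_limit hη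
  refine ⟨φ, h1, h2, h3, h4, h5, ?_⟩
  have h6 := H.mass.sub (H.weakStar φ h1 h2 h3)
  have h7 : ∀ j, ∫ x, (1 - inner ℝ (φ x) (ν j x)) ∂(l j)
      = (l j).real Set.univ - ∫ x, inner ℝ (φ x) (ν j x) ∂(l j) := fun j => by
    rw [integral_sub (integrable_const _) (integrable_inner (H.meas j) (H.norm_le j) h1 h4)]
    simp
  rw [integral_sub (integrable_const _) (integrable_inner H.meas_limit
    (H.norm_limit.mono fun x hx => hx.le) h1 h4)] at h5
  simp only [integral_const, smul_eq_mul, mul_one] at h5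
  simp only [h7]
  exact h6.eventually_lt_const h5

theorem abs_integral_sub_le {l : Measure (Vec d)} [IsFiniteMeasure l] (hl : l Ωᶜ = 0)
    {ν φ : Vec d → V} (hν : AEStronglyMeasurable ν l) (h1 : ∀ᵐ x ∂l, ‖ν x‖ ≤ 1)
    (hφ : Continuous φ) (hφ1 : ∀ x, ‖φ x‖ ≤ 1) {a b : Vec d → ℝ} (ha : Integrable a l)
    (hb : Integrable b l) {τ M : ℝ} (hab : ∀ x ∈ Ω, ‖ν x‖ ≤ 1 →
      |a x - b x| ≤ τ + M * (1 - inner ℝ (φ x) (ν x))) :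
    |∫ x, a x ∂l - ∫ x, b x ∂l|
      ≤ τ * l.real Set.univ + M * ∫ x, (1 - inner ℝ (φ x) (ν x)) ∂l := by
  have hi : Integrable (fun x => 1 - inner ℝ (φ x) (ν x)) l :=
    (integrable_const _).sub (integrable_inner hν h1 hφ hφ1)
  rw [← integral_sub ha hb, ← Real.norm_eq_abs]
  refine (norm_integral_le_integral_norm _).trans ?_
  calc ∫ x, ‖a x - b x‖ ∂l ≤ ∫ x, (τ + M * (1 - inner ℝ (φ x) (ν x))) ∂l := by
        refine integral_mono_ae (ha.sub hb).norm ((integrable_const _).add (hi.const_mul M)) ?_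
        filter_upwards [h1, measure_eq_zero_iff_ae_notMem.1 hl] with x hx hxΩ
        exact hab x (by simpa using hxΩ) hx
    _ = _ := by
        rw [integral_add (integrable_const _) (hi.const_mul M), integral_const_mul]
        simp [mul_comm]

theorem integrable_of_continuousOn {l : Measure (Vec d)} [IsFiniteMeasure l] (hl : l Ωᶜ = 0)
    (hΩ : IsOpen Ω) {ζ : Vec d → ℝ} (hζ : ContinuousOn ζ Ω) {C : ℝ} (hC : ∀ x ∈ Ω, |ζ x| ≤ C) :
    Integrable ζ l := by
  have h : l.restrict Ω = l := Measure.restrict_eq_self_of_ae_mem (by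
    filter_upwards [measure_eq_zero_iff_ae_notMem.1 hl] with x hx
    simpa using hx)
  refine Integrable.of_bound (h ▸ hζ.aestronglyMeasurable hΩ.measurableSet) C ?_
  filter_upwards [measure_eq_zero_iff_ae_notMem.1 hl] with x hx
  exact hC x (by simpa using hx)

/-- Weak convergence of the total variation measures. -/
theorem tendsto_integral (H : StrictConvergence Ω l ν m ν₀) {ζ : Vec d → ℝ}
    (hζ : ContinuousOn ζ Ω) {C : ℝ} (hC : ∀ x ∈ Ω, |ζ x| ≤ C) :
    Tendsto (fun j => ∫ x, ζ x ∂(l j)) atTop (𝓝 (∫ x, ζ x ∂m)) := by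
  have := H.finite_limit
  have := H.finite
  rw [Metric.tendsto_nhds]
  intro ε hε
  set M := |C| + 1 with hM
  have hM0 : 0 < M := by positivity
  obtain ⟨φ, h1, h2, h3, h4, h5, h6⟩ := H.exists_test (η := ε / (3 * M)) (by positivity)
  have hc : Continuous fun x => ζ x • φ x := by
    refine ContinuousOn.continuous_of_tsupport_subset (hζ.smul h1.continuousOn) H.isOpen ?_
    exact (tsupport_smul_subset_right _ _).trans h3
  have hw := H.weakStar _ hc h2.smul_left ((tsupport_smul_subset_right _ _).trans h3)
  -- Replacing `ζ` by `⟨ζφ, ν⟩` costs at most `M` times the defect, for the limit and for the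
  -- sequence alike, and the new integrals converge by the weak* hypothesis. Each of the three
  -- errors is at most `ε / 3`.
  have key : ∀ (l : Measure (Vec d)) (ν : Vec d → V), IsFiniteMeasure l → l Ωᶜ = 0 →
      AEStronglyMeasurable ν l → (∀ᵐ x ∂l, ‖ν x‖ ≤ 1) →
      |∫ x, ζ x ∂l - ∫ x, inner ℝ (ζ x • φ x) (ν x) ∂l|
        ≤ M * ∫ x, (1 - inner ℝ (φ x) (ν x)) ∂l := by
    intro l ν hl hl0 hν hν1
    have hζi := integrable_of_continuousOn hl0 H.isOpen hζ hC
    have hi : Integrable (fun x => inner ℝ (ζ x • φ x) (ν x)) l := by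
      refine (hζi.norm).mono (hc.aestronglyMeasurable.inner hν) ?_
      filter_upwards [hν1] with x hx
      refine (norm_inner_le_norm _ _).trans ?_
      rw [norm_norm, norm_smul, mul_assoc]
      exact mul_le_of_le_one_right (norm_nonneg _) (mul_le_one₀ (h4 x) (norm_nonneg _) hx)
    have := abs_integral_sub_le hl0 hν hν1 h1 h4 hζi hi (τ := 0) (M := M) ?_
    · simpa using this
    · intro x hx hx1
      have h7 : inner ℝ (φ x) (ν x) ≤ 1 :=
        (real_inner_le_norm _ _).trans (mul_le_one₀ (h4 x) (norm_nonneg _) hx1)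
      have h8 : ζ x - inner ℝ (ζ x • φ x) (ν x) = ζ x * (1 - inner ℝ (φ x) (ν x)) := by
        rw [real_inner_smul_left]; ring
      rw [h8, abs_mul, abs_of_nonneg (sub_nonneg.2 h7), zero_add]
      have := hC x hx
      have := le_abs_self C
      exact mul_le_mul_of_nonneg_right (by linarith) (sub_nonneg.2 h7)
  have hlim := key m ν₀ H.finite_limit H.carried_limit H.meas_limit
    (H.norm_limit.mono fun x hx => hx.le)
  have h9 : M * (ε / (3 * M)) = ε / 3 := by field_simp
  filter_upwards [h6, Metric.tendsto_nhds.1 hw (ε / 3) (by positivity)] with j hj1 hj2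
  have hj := key (l j) (ν j) (H.finite j) (H.carried j) (H.meas j) (H.norm_le j)
  have h10 := mul_lt_mul_of_pos_left h5 hM0
  have h11 := mul_lt_mul_of_pos_left hj1 hM0
  rw [h9] at h10 h11
  rw [Real.dist_eq] at hj2 ⊢
  rw [abs_lt] at hj2 ⊢
  rw [abs_le] at hlim hj
  constructor <;> linarith

theorem aestronglyMeasurable_comp [FiniteDimensional ℝ V] [MeasurableSpace V] [BorelSpace V]
    {l : Measure (Vec d)} (hl : l Ωᶜ = 0) (hΩ : IsOpen Ω) {h : Vec d × V → ℝ}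
    (hh : ContinuousOn h (Ω ×ˢ Set.univ)) {ν : Vec d → V} (hν : AEStronglyMeasurable ν l) :
    AEStronglyMeasurable (fun x => h (x, ν x)) l := by
  have hm : Measurable ((Ω ×ˢ (Set.univ : Set V)).indicator h) := by
    classical
    have := hh.measurable_piecewise (g := (0 : Vec d × V → ℝ)) continuousOn_const
      (hΩ.measurableSet.prod MeasurableSet.univ)
    rwa [Set.piecewise_eq_indicator] at this
  have h2 : AEMeasurable (fun x => (Ω ×ˢ (Set.univ : Set V)).indicator h (x, ν x)) l :=
    hm.comp_aemeasurable (aemeasurable_id.prodMk hν.aemeasurable)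
  refine h2.aestronglyMeasurable.congr ?_
  filter_upwards [measure_eq_zero_iff_ae_notMem.1 hl] with x hx
  exact Set.indicator_of_mem (show (x, ν x) ∈ Ω ×ˢ Set.univ from ⟨by simpa using hx, trivial⟩) h

/-- Uniform continuity settles `|z - z'| < δ`; otherwise `|z - z'|² / δ² ≥ 1` and the crude bound
`2|C|` suffices. The modulus is taken quadratic because the defect controls squares. -/
theorem exists_modulus {K : Set (Vec d)} [FiniteDimensional ℝ V] (hK : IsCompact K)
    {H : Vec d × V → ℝ} (hH : ContinuousOn H (K ×ˢ Metric.closedBall 0 1))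
    {C : ℝ} (hC : ∀ x ∈ K, ∀ z, ‖z‖ ≤ 1 → |H (x, z)| ≤ C) {τ : ℝ} (hτ : 0 < τ) :
    ∃ M, 0 ≤ M ∧ ∀ x ∈ K, ∀ z z', ‖z‖ ≤ 1 → ‖z'‖ ≤ 1 →
      |H (x, z) - H (x, z')| ≤ τ + M * ‖z - z'‖ ^ 2 := by
  have huc := (hK.prod (isCompact_closedBall (0 : V) 1)).uniformContinuousOn_of_continuous hH
  obtain ⟨δ, hδ, h⟩ := Metric.uniformContinuousOn_iff.1 huc τ hτ
  refine ⟨2 * |C| / δ ^ 2, by positivity, fun x hx z z' hz hz' => ?_⟩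
  by_cases hd : ‖z - z'‖ < δ
  · have := h (x, z) ⟨hx, by simpa using hz⟩ (x, z') ⟨hx, by simpa using hz'⟩
      (by simpa [Prod.dist_eq, dist_eq_norm, hδ] using hd)
    rw [Real.dist_eq] at this
    have h2 : 0 ≤ 2 * |C| / δ ^ 2 * ‖z - z'‖ ^ 2 := by positivity
    linarith
  · have h1 : |H (x, z) - H (x, z')| ≤ 2 * |C| := by
      have h3 := hC x hx z hz
      have h4 := hC x hx z' hz'
      have h5 := le_abs_self C
      have h6 := abs_sub (H (x, z)) (H (x, z'))
      linarith
    have h2 : 2 * |C| ≤ 2 * |C| / δ ^ 2 * ‖z - z'‖ ^ 2 := by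
      rw [div_mul_eq_mul_div, le_div_iff₀ (by positivity)]
      gcongr
      exact not_lt.1 hd
    linarith

theorem integrable_comp [FiniteDimensional ℝ V] [MeasurableSpace V] [BorelSpace V]
    {l : Measure (Vec d)} [IsFiniteMeasure l] (hl : l Ωᶜ = 0) (hΩ : IsOpen Ω) {h : Vec d × V → ℝ}
    (hh : ContinuousOn h (Ω ×ˢ Set.univ)) {ν : Vec d → V} (hν : AEStronglyMeasurable ν l)
    (h1 : ∀ᵐ x ∂l, ‖ν x‖ ≤ 1) {C : ℝ} (hC : ∀ x ∈ Ω, ∀ z, ‖z‖ ≤ 1 → |h (x, z)| ≤ C) :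
    Integrable (fun x => h (x, ν x)) l := by
  refine Integrable.of_bound (aestronglyMeasurable_comp hl hΩ hh hν) C ?_
  filter_upwards [measure_eq_zero_iff_ae_notMem.1 hl, h1] with x hx hx1
  exact hC x (by simpa using hx) _ hx1

/-- Freezing the field at a test field `φ` turns the integrand into the fixed bounded continuous
function `h(x, φ(x))`, for which `tendsto_integral` applies. The compact set `K` is what makes the
modulus of `h` uniform. -/
theorem tendsto_integral_comp_of_compact [FiniteDimensional ℝ V] [MeasurableSpace V] [BorelSpace V]
    (H : StrictConvergence Ω l ν m ν₀) {h : Vec d × V → ℝ}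
    (hh : ContinuousOn h (Ω ×ˢ Set.univ)) {C : ℝ} (hC : ∀ x ∈ Ω, ∀ z, ‖z‖ ≤ 1 → |h (x, z)| ≤ C)
    {K : Set (Vec d)} (hK : IsCompact K) (hKΩ : K ⊆ Ω) (hK0 : ∀ x ∉ K, ∀ z, h (x, z) = 0) :
    Tendsto (fun j => ∫ x, h (x, ν j x) ∂(l j)) atTop (𝓝 (∫ x, h (x, ν₀ x) ∂m)) := by
  have := H.finite_limit
  have := H.finite
  rw [Metric.tendsto_nhds]
  intro ε hε
  -- `L` exceeds the masses of all late measures. Five errors of size at most `ε / 6` arise: modulus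
  -- and defect, each for the limit and for index `j`, and the convergence of the frozen integrals.
  set L := m.real Set.univ + 1 with hL
  have hL0 : 0 < L := by positivity
  have hτ0 : 0 < ε / (6 * L) := by positivity
  obtain ⟨M, hM0, hM⟩ := exists_modulus hK
    (hh.mono (Set.prod_mono hKΩ (Set.subset_univ _))) (fun x hx => hC x (hKΩ hx)) hτ0
  obtain ⟨φ, h1, -, -, h4, h5, h6⟩ := H.exists_test (η := ε / (6 * (2 * M + 1))) (by positivity)
  have hζ : ContinuousOn (fun x => h (x, φ x)) Ω :=
    hh.comp (continuousOn_id.prodMk h1.continuousOn) fun x hx => ⟨hx, trivial⟩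
  have hζC : ∀ x ∈ Ω, |h (x, φ x)| ≤ C := fun x hx => hC x hx _ (h4 x)
  have hw := H.tendsto_integral hζ hζC
  have key : ∀ (l : Measure (Vec d)) (ν : Vec d → V), IsFiniteMeasure l → l Ωᶜ = 0 →
      AEStronglyMeasurable ν l → (∀ᵐ x ∂l, ‖ν x‖ ≤ 1) →
      |∫ x, h (x, ν x) ∂l - ∫ x, h (x, φ x) ∂l|
        ≤ ε / (6 * L) * l.real Set.univ + 2 * M * ∫ x, (1 - inner ℝ (φ x) (ν x)) ∂l := by
    intro l ν hl hl0 hν hν1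
    refine abs_integral_sub_le hl0 hν hν1 h1 h4 (integrable_comp hl0 H.isOpen hh hν hν1 hC)
      (integrable_of_continuousOn hl0 H.isOpen hζ hζC) fun x hx hx1 => ?_
    have h8 := norm_sub_sq_le_of_norm_le_one hx1 (h4 x)
    have h9 := mul_le_mul_of_nonneg_left h8 hM0
    by_cases hxK : x ∈ K
    · have := hM x hxK _ _ hx1 (h4 x)
      linarith
    · rw [hK0 x hxK, hK0 x hxK, sub_self, abs_zero]
      have : 0 ≤ M * ‖ν x - φ x‖ ^ 2 := by positivity
      linarith
  have hlim := key m ν₀ H.finite_limit H.carried_limit H.meas_limit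
    (H.norm_limit.mono fun x hx => hx.le)
  have hη : 2 * M * (ε / (6 * (2 * M + 1))) ≤ ε / 6 := by
    rw [mul_div_assoc', div_le_div_iff₀ (by positivity) (by positivity)]
    nlinarith
  have hτ : ∀ r : ℝ, r ≤ L → ε / (6 * L) * r ≤ ε / 6 := fun r hr => by
    calc ε / (6 * L) * r ≤ ε / (6 * L) * L := by gcongr
      _ = ε / 6 := by field_simp
  filter_upwards [h6, Metric.tendsto_nhds.1 hw (ε / 6) (by positivity),
    H.mass.eventually_le_const (show m.real Set.univ < L by linarith)] with j hj1 hj2 hj3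
  have hj := key (l j) (ν j) (H.finite j) (H.carried j) (H.meas j) (H.norm_le j)
  have h10 := mul_le_mul_of_nonneg_left h5.le (show 0 ≤ 2 * M by positivity)
  have h11 := mul_le_mul_of_nonneg_left hj1.le (show 0 ≤ 2 * M by positivity)
  have h12 := hτ _ hj3
  have h13 := hτ (m.real Set.univ) (by linarith)
  rw [Real.dist_eq] at hj2 ⊢
  rw [abs_lt] at hj2 ⊢
  rw [abs_le] at hlim hj
  constructor <;> linarith

/-- **Reshetnyak's continuity theorem.** -/
theorem tendsto_integral_comp [FiniteDimensional ℝ V] [MeasurableSpace V] [BorelSpace V]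
    (H : StrictConvergence Ω l ν m ν₀) {h : Vec d × V → ℝ}
    (hh : ContinuousOn h (Ω ×ˢ Set.univ)) {C : ℝ} (hC : ∀ x ∈ Ω, ∀ z, ‖z‖ ≤ 1 → |h (x, z)| ≤ C) :
    Tendsto (fun j => ∫ x, h (x, ν j x) ∂(l j)) atTop (𝓝 (∫ x, h (x, ν₀ x) ∂m)) := by
  have := H.finite_limit
  have := H.finite
  rw [Metric.tendsto_nhds]
  intro ε hε
  obtain ⟨ψ, hψ1, hψ2, hψ3, hψ4, hψ5⟩ := exists_cutoff H.isOpen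
  set M := |C| + 1 with hM
  have hM0 : 0 < M := by positivity
  have hlim : Tendsto (fun n => ∫ x, (1 - |ψ n x|) ∂m) atTop (𝓝 (∫ x, (0 : ℝ) ∂m)) := by
    refine tendsto_integral_of_dominated_convergence (fun _ => 1) (fun n => ?_)
      (integrable_const _) (fun n => Eventually.of_forall fun x => ?_) ?_
    · exact aestronglyMeasurable_const.sub (hψ1 n).continuous.abs.aestronglyMeasurable
    · rw [Real.norm_of_nonneg (sub_nonneg.2 (hψ4 n x))]
      linarith [abs_nonneg (ψ n x)]
    · filter_upwards [measure_eq_zero_iff_ae_notMem.1 H.carried_limit] with x hx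
      have h4 := hψ5 x
      rw [Set.indicator_of_mem (by simpa using hx)] at h4
      simpa using h4.abs.const_sub 1
  rw [integral_zero] at hlim
  obtain ⟨n, hn⟩ := (hlim.eventually_lt_const (show 0 < ε / (4 * M) by positivity)).exists
  have hψc : Continuous fun x => |ψ n x| := (hψ1 n).continuous.abs
  have hH : ContinuousOn (fun p : Vec d × V => |ψ n p.1| * h p) (Ω ×ˢ Set.univ) :=
    (hψc.comp continuous_fst).continuousOn.mul hh
  have hHC : ∀ x ∈ Ω, ∀ z, ‖z‖ ≤ 1 → |(fun p : Vec d × V => |ψ n p.1| * h p) (x, z)| ≤ M := by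
    intro x hx z hz
    have h1 := hC x hx z hz
    have h2 := le_abs_self C
    simp only [abs_mul, abs_abs]
    calc |ψ n x| * |h (x, z)| ≤ 1 * |h (x, z)| := by gcongr; exact hψ4 n x
      _ ≤ M := by linarith
  have hw := H.tendsto_integral_comp_of_compact hH hHC (hψ2 n) (hψ3 n) (fun x hx z => by
    simp [image_eq_zero_of_notMem_tsupport hx])
  -- Tightness: `1 - |ψ n|` is bounded and continuous though not compactly supported, so its
  -- integrals converge too and the mass missed by the cut-off is small for late indices.
  have hw2 := H.tendsto_integral (ζ := fun x => 1 - |ψ n x|) (C := 1)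
    (continuous_const.sub hψc).continuousOn (fun x _ => by
      rw [abs_of_nonneg (sub_nonneg.2 (hψ4 n x))]; linarith [abs_nonneg (ψ n x)])
  have key : ∀ (l : Measure (Vec d)) (ν : Vec d → V), IsFiniteMeasure l → l Ωᶜ = 0 →
      AEStronglyMeasurable ν l → (∀ᵐ x ∂l, ‖ν x‖ ≤ 1) →
      |∫ x, h (x, ν x) ∂l - ∫ x, |ψ n x| * h (x, ν x) ∂l| ≤ M * ∫ x, (1 - |ψ n x|) ∂l := by
    intro l ν hl hl0 hν hν1
    have hi1 := integrable_comp hl0 H.isOpen hh hν hν1 hC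
    have hi2 := integrable_comp hl0 H.isOpen hH hν hν1 hHC
    rw [← integral_sub hi1 hi2, ← Real.norm_eq_abs, ← integral_const_mul]
    refine norm_integral_le_of_norm_le ?_ ?_
    · refine (integrable_of_continuousOn hl0 H.isOpen (continuous_const.sub hψc).continuousOn
        (C := 1) fun x _ => ?_).const_mul M
      simp only [Pi.sub_apply]
      rw [abs_of_nonneg (sub_nonneg.2 (hψ4 n x))]
      linarith [abs_nonneg (ψ n x)]
    · filter_upwards [hν1, measure_eq_zero_iff_ae_notMem.1 hl0] with x hx hxΩ
      have h1 := hC x (by simpa using hxΩ) _ hx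
      have h2 := le_abs_self C
      have h3 : h (x, ν x) - |ψ n x| * h (x, ν x) = h (x, ν x) * (1 - |ψ n x|) := by ring
      rw [h3, norm_mul, Real.norm_of_nonneg (sub_nonneg.2 (hψ4 n x)), Real.norm_eq_abs]
      exact mul_le_mul_of_nonneg_right (by linarith) (sub_nonneg.2 (hψ4 n x))
  have hlim' := key m ν₀ H.finite_limit H.carried_limit H.meas_limit
    (H.norm_limit.mono fun x hx => hx.le)
  have h9 : M * (ε / (4 * M)) = ε / 4 := by field_simp
  filter_upwards [hw2.eventually_lt_const hn, Metric.tendsto_nhds.1 hw (ε / 4) (by positivity)]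
    with j hj1 hj2
  have hj := key (l j) (ν j) (H.finite j) (H.carried j) (H.meas j) (H.norm_le j)
  have h10 := mul_lt_mul_of_pos_left hn hM0
  have h11 := mul_lt_mul_of_pos_left hj1 hM0
  rw [h9] at h10 h11
  rw [Real.dist_eq] at hj2 ⊢
  rw [abs_lt] at hj2 ⊢
  rw [abs_le] at hlim' hj
  constructor <;> linarith

end StrictConvergence

end Reshetnyak


/-! ### The lifted measure `(dx, μ)` and its polar decomposition -/

theorem measurable_density {X : Type*} [MeasurableSpace X] (μ : VectorMeasure X (SymMat d))
    (ν : Measure X) : Measurable (density μ ν) := by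
  unfold density
  exact Finset.measurable_sum _ fun i _ =>
    (SignedMeasure.measurable_rnDeriv _ _).smul_const _

/-- The measure `√(1 + |dμ/dx|²) dx + |μˢ|` on `Ω`. -/
def liftMeasure (Ω : Set (Vec d)) (μ : VectorMeasure (Vec d) (SymMat d)) : Measure (Vec d) :=
  (volume.restrict Ω).withDensity
      (fun x => ENNReal.ofReal √(1 + ‖density μ volume x‖ ^ 2)) +
    (singularPart μ volume).variation

/-- A Lebesgue null set which carries the singular part. -/
def singularSet (μ : VectorMeasure (Vec d) (SymMat d)) : Set (Vec d) :=
  (exists_singularPart_eq_restrict μ volume).choose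

open scoped Classical in
/-- The polar vector of `(dx, μ)` with respect to `liftMeasure`. -/
def liftField (μ : VectorMeasure (Vec d) (SymMat d)) : Vec d → LiftVec d :=
  (singularSet μ).piecewise
    (fun x => WithLp.toLp 2
      (0, density (singularPart μ volume) (singularPart μ volume).variation x))
    (fun x => (√(1 + ‖density μ volume x‖ ^ 2))⁻¹ • WithLp.toLp 2 (1, density μ volume x))

section Lift

variable {Ω : Set (Vec d)} {μ : VectorMeasure (Vec d) (SymMat d)}

theorem measurableSet_singularSet : MeasurableSet (singularSet μ) :=
  (exists_singularPart_eq_restrict μ volume).choose_spec.1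

theorem volume_singularSet : volume (singularSet μ) = 0 :=
  (exists_singularPart_eq_restrict μ volume).choose_spec.2.1

theorem singularPart_eq_restrict : singularPart μ volume = μ.restrict (singularSet μ) :=
  (exists_singularPart_eq_restrict μ volume).choose_spec.2.2.1

theorem withDensityᵥ_density_eq_restrict :
    volume.withDensityᵥ (density μ volume) = μ.restrict (singularSet μ)ᶜ :=
  (exists_singularPart_eq_restrict μ volume).choose_spec.2.2.2

theorem variation_singularPart :
    (singularPart μ volume).variation = μ.variation.restrict (singularSet μ) := by
  rw [singularPart_eq_restrict, VectorMeasure.variation_restrict measurableSet_singularSet]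

instance [IsFiniteMeasure μ.variation] : IsFiniteMeasure (singularPart μ volume).variation := by
  rw [variation_singularPart]; infer_instance

theorem variation_singularPart_compl (hμ : μ.variation Ωᶜ = 0) :
    (singularPart μ volume).variation Ωᶜ = 0 := by
  rw [variation_singularPart]
  exact measure_mono_null subset_rfl (Measure.absolutelyContinuous_of_le Measure.restrict_le_self hμ)

theorem density_eq_zero_of_notMem (hΩ : MeasurableSet Ω) (hμ : μ.variation Ωᶜ = 0) :
    ∀ᵐ x ∂(volume : Measure (Vec d)), x ∉ Ω → density μ volume x = 0 := by
  have h1 := Measure.variation_withDensityᵥ (integrable_density μ volume)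
  have h2 : (volume.withDensity fun x => ‖density μ volume x‖ₑ) Ωᶜ = 0 := by
    rw [← h1, withDensityᵥ_density_eq_restrict,
      VectorMeasure.variation_restrict measurableSet_singularSet.compl]
    exact Measure.absolutelyContinuous_of_le Measure.restrict_le_self hμ
  rw [withDensity_apply _ hΩ.compl,
    lintegral_eq_zero_iff (measurable_density μ volume).enorm,
    Filter.EventuallyEq, ae_restrict_iff' hΩ.compl] at h2
  filter_upwards [h2] with x hx hxΩ
  simpa using hx hxΩ

theorem sqrt_one_add_sq_pos (r : ℝ) : 0 < √(1 + r ^ 2) := by positivity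

theorem measurable_area_integrand :
    Measurable fun x => √(1 + ‖density μ volume x‖ ^ 2) :=
  ((((measurable_density μ volume).norm).pow_const 2).const_add 1).sqrt

theorem sqrt_one_add_sq_le {r : ℝ} (hr : 0 ≤ r) : √(1 + r ^ 2) ≤ 1 + r := by
  rw [Real.sqrt_le_left (by positivity)]
  nlinarith

theorem integrableOn_area_integrand (hvol : volume Ω ≠ ⊤) :
    IntegrableOn (fun x => √(1 + ‖density μ volume x‖ ^ 2)) Ω := by
  have : IsFiniteMeasure (volume.restrict Ω) := ⟨by simpa using hvol.lt_top⟩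
  refine Integrable.mono ((integrable_const (1 : ℝ)).add
    (integrable_density μ volume).norm.integrableOn) measurable_area_integrand.aestronglyMeasurable
    (Eventually.of_forall fun x => ?_)
  rw [Real.norm_of_nonneg (by positivity), Real.norm_of_nonneg (by simp only [Pi.add_apply]; positivity)]
  exact sqrt_one_add_sq_le (norm_nonneg _)

theorem isFiniteMeasure_liftMeasure [IsFiniteMeasure μ.variation] (hvol : volume Ω ≠ ⊤) :
    IsFiniteMeasure (liftMeasure Ω μ) := by
  have := isFiniteMeasure_withDensity_ofReal (integrableOn_area_integrand (μ := μ) hvol).2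
  unfold liftMeasure
  infer_instance

theorem liftMeasure_compl (hΩ : MeasurableSet Ω) (hμ : μ.variation Ωᶜ = 0) :
    liftMeasure Ω μ Ωᶜ = 0 := by
  rw [liftMeasure, Measure.add_apply, variation_singularPart_compl hμ, add_zero]
  refine withDensity_absolutelyContinuous _ _ ?_
  rw [Measure.restrict_apply hΩ.compl, Set.compl_inter_self, measure_empty]

theorem measurable_liftField : Measurable (liftField μ) := by
  classical
  unfold liftField
  have h1 := WithLp.measurable_toLp 2 (ℝ × SymMat d)
  refine Measurable.piecewise measurableSet_singularSet ?_ ?_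
  · exact h1.comp (measurable_const.prodMk (measurable_density _ _))
  · exact measurable_area_integrand.inv.smul
      (h1.comp (measurable_const.prodMk (measurable_density _ _)))

theorem liftField_of_notMem {x : Vec d} (hx : x ∉ singularSet μ) :
    liftField μ x
      = (√(1 + ‖density μ volume x‖ ^ 2))⁻¹ • WithLp.toLp 2 (1, density μ volume x) := by
  classical
  exact Set.piecewise_eq_of_notMem _ _ _ hx

theorem liftField_of_mem {x : Vec d} (hx : x ∈ singularSet μ) :
    liftField μ x = WithLp.toLp 2
      (0, density (singularPart μ volume) (singularPart μ volume).variation x) := by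
  classical
  exact Set.piecewise_eq_of_mem _ _ _ hx

theorem ae_liftField_absolutelyContinuous :
    ∀ᵐ x ∂(volume.restrict Ω), liftField μ x
      = (√(1 + ‖density μ volume x‖ ^ 2))⁻¹ • WithLp.toLp 2 (1, density μ volume x) := by
  filter_upwards [ae_restrict_of_ae (measure_eq_zero_iff_ae_notMem.1 (volume_singularSet (μ := μ)))]
    with x hx
  exact liftField_of_notMem hx

theorem ae_liftField_singular :
    ∀ᵐ x ∂(singularPart μ volume).variation, liftField μ x = WithLp.toLp 2
      (0, density (singularPart μ volume) (singularPart μ volume).variation x) := by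
  have h : ∀ᵐ x ∂(singularPart μ volume).variation, x ∈ singularSet μ := by
    rw [variation_singularPart]
    exact ae_restrict_mem measurableSet_singularSet
  filter_upwards [h] with x hx
  exact liftField_of_mem hx

theorem norm_liftField [IsFiniteMeasure μ.variation] :
    ∀ᵐ x ∂(liftMeasure Ω μ), ‖liftField μ x‖ = 1 := by
  rw [liftMeasure, ae_add_measure_iff]
  constructor
  · refine (withDensity_absolutelyContinuous _ _).ae_le ?_
    filter_upwards [ae_liftField_absolutelyContinuous] with x hx
    have h0 := sqrt_one_add_sq_pos ‖density μ volume x‖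
    rw [hx, norm_smul, norm_inv, Real.norm_of_nonneg h0.le, WithLp.prod_norm_eq_of_L2]
    simp only [WithLp.toLp_fst, WithLp.toLp_snd, norm_one, one_pow]
    exact inv_mul_cancel₀ h0.ne'
  · filter_upwards [ae_liftField_singular, norm_density_variation (singularPart μ volume)]
      with x hx hx1
    rw [hx, WithLp.prod_norm_eq_of_L2]
    simp [hx1]

variable {E : Type*} [NormedAddCommGroup E] [NormedSpace ℝ E]

/-- Integration against the lifted measure. -/
theorem integral_liftMeasure {G : Vec d → LiftVec d → E}
    (hG : Integrable (fun x => G x (liftField μ x)) (liftMeasure Ω μ)) :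
    Integrable (fun x => √(1 + ‖density μ volume x‖ ^ 2) •
        G x ((√(1 + ‖density μ volume x‖ ^ 2))⁻¹ • WithLp.toLp 2 (1, density μ volume x)))
      (volume.restrict Ω) ∧
    Integrable (fun x => G x (WithLp.toLp 2
      (0, density (singularPart μ volume) (singularPart μ volume).variation x)))
      (singularPart μ volume).variation ∧
    ∫ x, G x (liftField μ x) ∂(liftMeasure Ω μ) =
      (∫ x in Ω, √(1 + ‖density μ volume x‖ ^ 2) •
        G x ((√(1 + ‖density μ volume x‖ ^ 2))⁻¹ • WithLp.toLp 2 (1, density μ volume x))) +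
      ∫ x, G x (WithLp.toLp 2
        (0, density (singularPart μ volume) (singularPart μ volume).variation x))
        ∂(singularPart μ volume).variation := by
  rw [liftMeasure] at hG ⊢
  obtain ⟨h1, h2⟩ := integrable_add_measure.1 hG
  have hm := (measurable_area_integrand (μ := μ)).ennreal_ofReal
  have hfin : ∀ᵐ x ∂(volume.restrict Ω),
      ENNReal.ofReal √(1 + ‖density μ volume x‖ ^ 2) < ⊤ :=
    Eventually.of_forall fun x => ENNReal.ofReal_lt_top
  have hr : ∀ x, (ENNReal.ofReal √(1 + ‖density μ volume x‖ ^ 2)).toReal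
      = √(1 + ‖density μ volume x‖ ^ 2) := fun x => ENNReal.toReal_ofReal (by positivity)
  have h3 : (fun x => √(1 + ‖density μ volume x‖ ^ 2) • G x (liftField μ x))
      =ᵐ[volume.restrict Ω] fun x => √(1 + ‖density μ volume x‖ ^ 2) •
        G x ((√(1 + ‖density μ volume x‖ ^ 2))⁻¹ • WithLp.toLp 2 (1, density μ volume x)) := by
    filter_upwards [ae_liftField_absolutelyContinuous] with x hx
    rw [hx]
  have h4 : (fun x => G x (liftField μ x)) =ᵐ[(singularPart μ volume).variation]
      fun x => G x (WithLp.toLp 2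
        (0, density (singularPart μ volume) (singularPart μ volume).variation x)) := by
    filter_upwards [ae_liftField_singular] with x hx
    rw [hx]
  refine ⟨?_, h2.congr h4, ?_⟩
  · have h5 := (integrable_withDensity_iff_integrable_smul' hm hfin).1 h1
    simp only [hr] at h5
    exact h5.congr h3
  · rw [integral_add_measure h1 h2, integral_withDensity_eq_integral_toReal_smul hm hfin,
      integral_congr_ae h4]
    simp only [hr]
    rw [integral_congr_ae h3]

/-- Through this identity convergence of areas becomes the mass condition of `StrictConvergence`. -/
theorem liftMeasure_real_univ [IsFiniteMeasure μ.variation] (hvol : volume Ω ≠ ⊤)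
    (hμ : μ.variation Ωᶜ = 0) : (liftMeasure Ω μ).real Set.univ = area Ω μ := by
  have := isFiniteMeasure_liftMeasure (μ := μ) hvol
  have h := (integral_liftMeasure (Ω := Ω) (μ := μ) (G := fun _ _ => (1 : ℝ))
    (integrable_const _)).2.2
  simp only [integral_const, smul_eq_mul, mul_one] at h
  rw [h, area]
  congr 1
  refine measureReal_congr ?_
  filter_upwards [measure_eq_zero_iff_ae_notMem.1 (variation_singularPart_compl hμ)] with x hx
  have : x ∈ Ω := by simpa using hx
  exact propext ⟨fun _ => this, fun _ => trivial⟩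

/-- The lifted measure and field represent the vector measure `(dx, μ)`. -/
theorem integral_smul_liftField [IsFiniteMeasure μ.variation] (hΩ : MeasurableSet Ω)
    (hvol : volume Ω ≠ ⊤) (hμ : μ.variation Ωᶜ = 0) {k : Vec d → ℝ} (hk : StronglyMeasurable k)
    {C : ℝ} (hC : ∀ x, ‖k x‖ ≤ C) :
    ∫ x, k x • liftField μ x ∂(liftMeasure Ω μ)
      = WithLp.toLp 2 (∫ x in Ω, k x, ∫ᵛ x, k x ∂•μ) := by
  have := isFiniteMeasure_liftMeasure (μ := μ) hvol
  have hi : Integrable (fun x => k x • liftField μ x) (liftMeasure Ω μ) := by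
    refine Integrable.of_bound (hk.aestronglyMeasurable.smul
      measurable_liftField.aestronglyMeasurable) C ?_
    filter_upwards [norm_liftField (Ω := Ω) (μ := μ)] with x hx
    rw [norm_smul, hx, mul_one]
    exact hC x
  obtain ⟨h1, h2, h3⟩ := integral_liftMeasure (G := fun x z => k x • z) hi
  have h4 : ∀ x, √(1 + ‖density μ volume x‖ ^ 2) • k x •
      (√(1 + ‖density μ volume x‖ ^ 2))⁻¹ • (WithLp.toLp 2 (1, density μ volume x) : LiftVec d)
      = k x • WithLp.toLp 2 (1, density μ volume x) := fun x => by
    rw [smul_comm (√(1 + ‖density μ volume x‖ ^ 2)), smul_smul (√(1 + ‖density μ volume x‖ ^ 2)),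
      mul_inv_cancel₀ (sqrt_one_add_sq_pos _).ne', one_smul]
  simp only [h4] at h1 h3
  rw [h3]
  have hfst : ∀ (m : Measure (Vec d)) (F : Vec d → LiftVec d), Integrable F m →
      (∫ x, F x ∂m).fst = ∫ x, (F x).fst ∂m := fun m F hF =>
    ((WithLp.fstL 2 ℝ ℝ (SymMat d)).integral_comp_comm hF).symm
  have hsnd : ∀ (m : Measure (Vec d)) (F : Vec d → LiftVec d), Integrable F m →
      (∫ x, F x ∂m).snd = ∫ x, (F x).snd ∂m := fun m F hF =>
    ((WithLp.sndL 2 ℝ ℝ (SymMat d)).integral_comp_comm hF).symm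
  have hvar : IsFiniteMeasure (volume.withDensityᵥ (density μ volume)).variation := by
    rw [Measure.variation_withDensityᵥ (integrable_density μ volume)]
    exact isFiniteMeasure_withDensity (integrable_density μ volume).2.ne
  have hkI : ∀ ρ : VectorMeasure (Vec d) (SymMat d), IsFiniteMeasure ρ.variation →
      ρ.Integrable k := fun ρ hρ =>
    Integrable.of_bound hk.aestronglyMeasurable C (Eventually.of_forall hC)
  refine (WithLp.ofLp_injective 2) (Prod.ext ?_ ?_)
  · change WithLp.fst _ = WithLp.fst _
    rw [WithLp.add_fst, hfst _ _ h1, hfst _ _ h2]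
    simp
  · change WithLp.snd _ = WithLp.snd _
    rw [WithLp.add_snd, hsnd _ _ h1, hsnd _ _ h2]
    simp only [WithLp.smul_snd, WithLp.toLp_snd]
    conv_rhs => rw [← withDensityᵥ_density_add_singularPart μ volume]
    rw [VectorMeasure.integral_add_vectorMeasure (hkI _ hvar) (hkI _ inferInstance),
      integral_withDensityᵥ_smul (integrable_density μ volume) hk hC]
    congr 1
    -- The lifted measure integrates the density over `Ω` only, whereas `μ` lives on the whole
    -- space; the density vanishes almost everywhere outside `Ω`.
    · refine setIntegral_eq_integral_of_ae_compl_eq_zero ?_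
      filter_upwards [density_eq_zero_of_notMem hΩ hμ] with x hx hxΩ
      rw [hx hxΩ, smul_zero]
    · conv_rhs => rw [← withDensityᵥ_density_variation (singularPart μ volume)]
      rw [integral_withDensityᵥ_smul (integrable_density _ _) hk hC]

/-- Integrals of positively `1`-homogeneous functions against the lifted measure. -/
theorem integral_homogeneous_liftMeasure [IsFiniteMeasure μ.variation] (hΩ : IsOpen Ω)
    (hvol : volume Ω ≠ ⊤) (hμ : μ.variation Ωᶜ = 0) {h : Vec d × LiftVec d → ℝ}
    (hcont : ContinuousOn h (Ω ×ˢ Set.univ)) {C : ℝ} (hC : ∀ x ∈ Ω, ∀ z, ‖z‖ ≤ 1 → |h (x, z)| ≤ C)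
    (hsmul : ∀ x z, ∀ c : ℝ, 0 < c → h (x, c • z) = c * h (x, z)) :
    IntegrableOn (fun x => h (x, WithLp.toLp 2 (1, density μ volume x))) Ω ∧
    Integrable (fun x => h (x, WithLp.toLp 2
      (0, density (singularPart μ volume) (singularPart μ volume).variation x)))
      (singularPart μ volume).variation ∧
    ∫ x, h (x, liftField μ x) ∂(liftMeasure Ω μ) =
      (∫ x in Ω, h (x, WithLp.toLp 2 (1, density μ volume x))) +
      ∫ x, h (x, WithLp.toLp 2
        (0, density (singularPart μ volume) (singularPart μ volume).variation x))
        ∂(singularPart μ volume).variation := by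
  have := isFiniteMeasure_liftMeasure (μ := μ) hvol
  have hi := StrictConvergence.integrable_comp (liftMeasure_compl hΩ.measurableSet hμ) hΩ hcont
    (measurable_liftField (μ := μ)).aestronglyMeasurable
    (norm_liftField.mono fun x hx => hx.le) hC
  have h1 := integral_liftMeasure (G := fun x z => h (x, z)) hi
  -- Homogeneity cancels the weight of the lifted measure against the normalization of its polar
  -- field.
  have h2 : ∀ x, √(1 + ‖density μ volume x‖ ^ 2) •
      h (x, (√(1 + ‖density μ volume x‖ ^ 2))⁻¹ • WithLp.toLp 2 (1, density μ volume x))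
      = h (x, WithLp.toLp 2 (1, density μ volume x)) := fun x => by
    have h0 := sqrt_one_add_sq_pos ‖density μ volume x‖
    rw [hsmul _ _ _ (inv_pos.2 h0), smul_eq_mul, mul_inv_cancel_left₀ h0.ne']
  simp only [h2] at h1
  exact h1

end Lift


/-! ### Weak* convergence of lifts and lower semicontinuity of the area -/

section LiftConvergence

variable {Ω : Set (Vec d)} {μ : VectorMeasure (Vec d) (SymMat d)}

/-- Expanding `φ` in an orthonormal basis leaves only scalar test functions. On the right `μ` enters
solely through scalar integrals, to which weak* convergence applies. -/
theorem integral_inner_liftField [IsFiniteMeasure μ.variation] (hΩ : MeasurableSet Ω)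
    (hvol : volume Ω ≠ ⊤) (hμ : μ.variation Ωᶜ = 0) {φ : Vec d → LiftVec d} (hφ : Continuous φ)
    (hc : HasCompactSupport φ) :
    ∫ x, inner ℝ (φ x) (liftField μ x) ∂(liftMeasure Ω μ) =
      ∑ i, inner ℝ (stdOrthonormalBasis ℝ (LiftVec d) i)
        (WithLp.toLp 2 (∫ x in Ω, inner ℝ (φ x) (stdOrthonormalBasis ℝ (LiftVec d) i),
          ∫ᵛ x, (inner ℝ (φ x) (stdOrthonormalBasis ℝ (LiftVec d) i) : ℝ) ∂•μ)) := by
  have := isFiniteMeasure_liftMeasure (μ := μ) hvol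
  set b := stdOrthonormalBasis ℝ (LiftVec d)
  obtain ⟨C, hC⟩ := hc.exists_bound_of_continuous hφ
  have hk : ∀ i, Continuous fun x => (inner ℝ (φ x) (b i) : ℝ) := fun i =>
    hφ.inner continuous_const
  have hkC : ∀ i x, ‖(inner ℝ (φ x) (b i) : ℝ)‖ ≤ C := fun i x => by
    refine (norm_inner_le_norm _ _).trans ?_
    rw [b.norm_eq_one, mul_one]
    exact hC x
  have hi : ∀ i, Integrable (fun x => (inner ℝ (φ x) (b i) : ℝ) • liftField μ x)
      (liftMeasure Ω μ) := fun i => by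
    refine Integrable.of_bound ((hk i).aestronglyMeasurable.smul
      measurable_liftField.aestronglyMeasurable) C ?_
    filter_upwards [norm_liftField (Ω := Ω) (μ := μ)] with x hx
    rw [norm_smul, hx, mul_one]
    exact hkC i x
  have h1 : ∀ x, inner ℝ (φ x) (liftField μ x)
      = ∑ i, inner ℝ (b i) ((inner ℝ (φ x) (b i) : ℝ) • liftField μ x) := fun x => by
    rw [← b.sum_inner_mul_inner]
    simp only [real_inner_smul_right]
  simp only [h1]
  rw [integral_finsetSum _ fun i _ => (hi i).const_inner (b i)]
  refine Finset.sum_congr rfl fun i _ => ?_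
  rw [integral_inner (hi i), integral_smul_liftField hΩ hvol hμ (hk i).stronglyMeasurable (hkC i)]

variable {μs : ℕ → VectorMeasure (Vec d) (SymMat d)}

theorem tendsto_integral_inner_liftField [IsFiniteMeasure μ.variation]
    (hfin : ∀ j, IsFiniteMeasure (μs j).variation) (hΩ : MeasurableSet Ω)
    (hvol : volume Ω ≠ ⊤) (hμ : μ.variation Ωᶜ = 0) (hμs : ∀ j, (μs j).variation Ωᶜ = 0)
    (hw : ∀ k : Vec d → ℝ, Continuous k → HasCompactSupport k → tsupport k ⊆ Ω →
      Tendsto (fun j => ∫ᵛ x, k x ∂•(μs j)) atTop (𝓝 (∫ᵛ x, k x ∂•μ)))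
    {φ : Vec d → LiftVec d} (hφ : Continuous φ) (hc : HasCompactSupport φ) (hs : tsupport φ ⊆ Ω) :
    Tendsto (fun j => ∫ x, inner ℝ (φ x) (liftField (μs j) x) ∂(liftMeasure Ω (μs j))) atTop
      (𝓝 (∫ x, inner ℝ (φ x) (liftField μ x) ∂(liftMeasure Ω μ))) := by
  simp only [integral_inner_liftField hΩ hvol hμ hφ hc,
    fun j => integral_inner_liftField hΩ hvol (hμs j) hφ hc]
  refine tendsto_finsetSum _ fun i _ => Tendsto.inner tendsto_const_nhds ?_
  refine ((WithLp.prod_continuous_toLp 2 ℝ (SymMat d)).tendsto _).comp ?_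
  have hsub : Function.support (fun x => (inner ℝ (φ x)
      (stdOrthonormalBasis ℝ (LiftVec d) i) : ℝ)) ⊆ Function.support φ := by
    intro x hx h0
    exact hx (by simp [h0])
  refine Tendsto.prodMk_nhds tendsto_const_nhds (hw _ (hφ.inner continuous_const) ?_ ?_)
  · exact hc.mono hsub
  · exact (closure_mono hsub).trans hs

theorem strictConvergence_lift [IsFiniteMeasure μ.variation]
    (hfin : ∀ j, IsFiniteMeasure (μs j).variation) (hΩ : IsOpen Ω)
    (hvol : volume Ω ≠ ⊤) (hμ : μ.variation Ωᶜ = 0) (hμs : ∀ j, (μs j).variation Ωᶜ = 0)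
    (hw : ∀ k : Vec d → ℝ, Continuous k → HasCompactSupport k → tsupport k ⊆ Ω →
      Tendsto (fun j => ∫ᵛ x, k x ∂•(μs j)) atTop (𝓝 (∫ᵛ x, k x ∂•μ)))
    (ha : Tendsto (fun j => area Ω (μs j)) atTop (𝓝 (area Ω μ))) :
    StrictConvergence Ω (fun j => liftMeasure Ω (μs j)) (fun j => liftField (μs j))
      (liftMeasure Ω μ) (liftField μ) where
  isOpen := hΩ
  finite j := isFiniteMeasure_liftMeasure hvol
  finite_limit := isFiniteMeasure_liftMeasure hvol
  carried j := liftMeasure_compl hΩ.measurableSet (hμs j)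
  carried_limit := liftMeasure_compl hΩ.measurableSet hμ
  meas j := measurable_liftField.aestronglyMeasurable
  meas_limit := measurable_liftField.aestronglyMeasurable
  norm_le j := norm_liftField.mono fun x hx => hx.le
  norm_limit := norm_liftField
  weakStar φ h1 h2 h3 :=
    tendsto_integral_inner_liftField hfin hΩ.measurableSet hvol hμ hμs hw h1 h2 h3
  mass := by simpa only [liftMeasure_real_univ hvol hμ,
    fun j => liftMeasure_real_univ hvol (hμs j)] using ha

/-- Lower semicontinuity of the area functional under weak* convergence. -/
theorem eventually_lt_area [IsFiniteMeasure μ.variation]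
    (hfin : ∀ j, IsFiniteMeasure (μs j).variation) (hΩ : IsOpen Ω)
    (hvol : volume Ω ≠ ⊤) (hμ : μ.variation Ωᶜ = 0) (hμs : ∀ j, (μs j).variation Ωᶜ = 0)
    (hw : ∀ k : Vec d → ℝ, Continuous k → HasCompactSupport k → tsupport k ⊆ Ω →
      Tendsto (fun j => ∫ᵛ x, k x ∂•(μs j)) atTop (𝓝 (∫ᵛ x, k x ∂•μ)))
    {a : ℝ} (ha : a < area Ω μ) : ∀ᶠ j in atTop, a < area Ω (μs j) := by
  have := isFiniteMeasure_liftMeasure (μ := μ) hvol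
  have := fun j => isFiniteMeasure_liftMeasure (μ := μs j) hvol
  -- A test field whose defect is below `area Ω μ - a` pairs with the limit to more than `a`. The
  -- pairing passes to the limit and never exceeds the total mass of the lift of `μs j`, which is
  -- its area.
  obtain ⟨φ, h1, h2, h3, h4, h5⟩ := exists_test_field hΩ
    (liftMeasure_compl hΩ.measurableSet hμ) (measurable_liftField (μ := μ)).aestronglyMeasurable
    norm_liftField (sub_pos.2 ha)
  rw [integral_sub (integrable_const _) (StrictConvergence.integrable_inner
    measurable_liftField.aestronglyMeasurable (norm_liftField.mono fun x hx => hx.le) h1 h4)] at h5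
  simp only [integral_const, smul_eq_mul, mul_one, liftMeasure_real_univ hvol hμ] at h5
  have h6 := tendsto_integral_inner_liftField hfin hΩ.measurableSet hvol hμ hμs hw h1 h2 h3
  filter_upwards [h6.eventually_const_lt (show a < _ by linarith)] with j hj
  refine hj.trans_le ?_
  rw [← liftMeasure_real_univ hvol (hμs j)]
  calc _ ≤ ∫ x, (1 : ℝ) ∂(liftMeasure Ω (μs j)) := by
        refine integral_mono_ae (StrictConvergence.integrable_inner
          measurable_liftField.aestronglyMeasurable (norm_liftField.mono fun x hx => hx.le) h1 h4)
          (integrable_const _) ?_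
        filter_upwards [norm_liftField (Ω := Ω) (μ := μs j)] with x hx
        refine (real_inner_le_norm _ _).trans ?_
        rw [hx, mul_one]
        exact h4 x
    _ = _ := by simp

end LiftConvergence

/-! ### The functional on `BD(Ω)` as an integral against the lift -/

namespace BD

variable {Ω : Set (Vec d)}

theorem isSymDeriv (u : BD Ω) : IsSymDeriv Ω u.1 u.symDeriv := u.2.choose_spec

theorem StrictTendsto.strictConvergence (hΩ : IsOpen Ω) (hvol : volume Ω ≠ ⊤) {v : ℕ → BD Ω}
    {u : BD Ω} (h : StrictTendsto v u) :
    StrictConvergence Ω (fun j => liftMeasure Ω (v j).symDeriv) (fun j => liftField (v j).symDeriv)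
      (liftMeasure Ω u.symDeriv) (liftField u.symDeriv) := by
  have := u.isSymDeriv.finite
  refine strictConvergence_lift (fun j => (v j).isSymDeriv.finite) hΩ hvol u.isSymDeriv.carried
    (fun j => (v j).isSymDeriv.carried) (fun k hk hc hs => ?_) h.area
  exact h.weakStar ⟨⟨k, hk⟩, hc.is_zero_at_infty⟩
    fun x hx => image_eq_zero_of_notMem_tsupport fun hx' => hx (hs hx')

/-- The functional with a recession term, as an integral against the lifted measure. -/
theorem integral_recession {f : Vec d → SymMat d → ℝ} (hΩ : IsOpen Ω) (hvol : volume Ω ≠ ⊤)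
    {h : Vec d × LiftVec d → ℝ} (hcont : ContinuousOn h (closure Ω ×ˢ Set.univ)) {C : ℝ}
    (hC : ∀ x ∈ closure Ω, ∀ z, ‖z‖ ≤ 1 → |h (x, z)| ≤ C)
    (hsmul : ∀ x z, ∀ c : ℝ, 0 < c → h (x, c • z) = c * h (x, z))
    (hf : ∀ x ∈ Ω, ∀ A, h (x, WithLp.toLp 2 (1, A)) = f x A) (u : BD Ω) :
    IntegrableOn (fun x => f x (u.approxSymGrad x)) Ω volume ∧
    IntegrableOn (fun x => recession Ω f x (density u.singularDeriv u.singularDeriv.variation x))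
      Ω u.singularDeriv.variation ∧
    (∫ x in Ω, f x (u.approxSymGrad x)) +
        ∫ x in Ω, recession Ω f x (density u.singularDeriv u.singularDeriv.variation x)
          ∂u.singularDeriv.variation
      = ∫ x, h (x, liftField u.symDeriv x) ∂(liftMeasure Ω u.symDeriv) := by
  have := u.isSymDeriv.finite
  obtain ⟨h1, h2, h3⟩ := integral_homogeneous_liftMeasure hΩ hvol u.isSymDeriv.carried
    (hcont.mono (Set.prod_mono subset_closure subset_rfl))
    (fun x hx => hC x (subset_closure hx)) hsmul
  have hr : u.singularDeriv.variation.restrict Ω = u.singularDeriv.variation := by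
    refine Measure.restrict_eq_self_of_ae_mem ?_
    filter_upwards [measure_eq_zero_iff_ae_notMem.1
      (variation_singularPart_compl u.isSymDeriv.carried)] with x hx
    simpa using hx
  have e1 : Set.EqOn (fun x => f x (u.approxSymGrad x))
      (fun x => h (x, WithLp.toLp 2 (1, density u.symDeriv volume x))) Ω :=
    fun x hx => (hf x hx _).symm
  have e2 : Set.EqOn
      (fun x => recession Ω f x (density u.singularDeriv u.singularDeriv.variation x))
      (fun x => h (x, WithLp.toLp 2
        (0, density u.singularDeriv u.singularDeriv.variation x))) Ω :=
    fun x hx => recession_eq_of_perspective hcont hsmul hf (subset_closure hx) _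
  refine ⟨h1.congr_fun e1.symm hΩ.measurableSet, ?_, ?_⟩
  · refine IntegrableOn.congr_fun ?_ e2.symm hΩ.measurableSet
    exact h2.integrableOn
  · rw [setIntegral_congr_fun hΩ.measurableSet e1, setIntegral_congr_fun hΩ.measurableSet e2, hr]
    exact h3.symm

end BD


/-! ### Absolutely convergent series in `L¹` -/

section Series

variable {X V W Z : Type*} [MeasurableSpace X] {m : Measure X}
  [NormedAddCommGroup V]

/-- An absolutely convergent series in `L¹` converges almost everywhere. -/
theorem exists_integrable_hasSum [CompleteSpace V] {F : ℕ → X → V} (hF : ∀ k, Integrable (F k) m)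
    {c : ℕ → ℝ} (hc : Summable c) (hle : ∀ k, ∫ x, ‖F k x‖ ∂m ≤ c k) :
    ∃ S : X → V, Integrable S m ∧ (∀ᵐ x ∂m, HasSum (fun k => F k x) (S x)) ∧
      ∫ x, ‖S x‖ ∂m ≤ ∑' k, c k := by
  have hn : ∀ k, ‖(hF k).toL1‖ = ∫ x, ‖F k x‖ ∂m := fun k => by
    rw [L1.norm_eq_integral_norm]
    refine integral_congr_ae ?_
    filter_upwards [(hF k).coeFn_toL1] with x hx
    rw [hx]
  have hsum : Summable fun k => ‖(hF k).toL1‖ :=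
    Summable.of_nonneg_of_le (fun k => norm_nonneg _) (fun k => (hn k).le.trans (hle k)) hc
  refine ⟨(∑' k, (hF k).toL1 : Lp V 1 m), L1.integrable_coeFn _, ?_, ?_⟩
  · filter_upwards [Lp.hasSum_coeFn_tsum (tsum_enorm_ne_top_iff_summable_norm.2 hsum),
      ae_all_iff.2 fun k => (hF k).coeFn_toL1] with x h1 h2
    simpa only [h2] using h1
  · rw [← L1.norm_eq_integral_norm]
    refine (norm_tsum_le_tsum_norm hsum).trans ?_
    exact hsum.tsum_le_tsum (fun k => (hn k).le.trans (hle k)) hc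

variable [NormedSpace ℝ V] [NormedAddCommGroup W] [NormedSpace ℝ W]
  [NormedAddCommGroup Z] [NormedSpace ℝ Z]

theorem integrable_bilin_of_bound (B : V →L[ℝ] W →L[ℝ] Z) {F : X → V} (hF : Integrable F m)
    {Ψ : X → W} (hΨ : AEStronglyMeasurable Ψ m) {C : ℝ} (hC : ∀ x, ‖Ψ x‖ ≤ C) :
    Integrable (fun x => B (F x) (Ψ x)) m := by
  refine Integrable.mono' (hF.norm.const_mul (‖B‖ * C))
    (B.aestronglyMeasurable_comp₂ hF.1 hΨ) (Eventually.of_forall fun x => ?_)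
  calc ‖B (F x) (Ψ x)‖ ≤ ‖B‖ * ‖F x‖ * ‖Ψ x‖ := B.le_opNorm₂ _ _
    _ ≤ ‖B‖ * ‖F x‖ * C := by gcongr; exact hC x
    _ = ‖B‖ * C * ‖F x‖ := by ring

/-- Summable `L¹` norms permit termwise integration against a bounded field. A general `B` covers
both scalar multiplication and `symTensor`. -/
theorem hasSum_integral_bilin [CompleteSpace Z] (B : V →L[ℝ] W →L[ℝ] Z) {F : ℕ → X → V}
    (hF : ∀ k, Integrable (F k) m) {c : ℕ → ℝ} (hc : Summable c)
    (hle : ∀ k, ∫ x, ‖F k x‖ ∂m ≤ c k) {S : X → V}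
    (hS : ∀ᵐ x ∂m, HasSum (fun k => F k x) (S x)) {Ψ : X → W}
    (hΨ : AEStronglyMeasurable Ψ m) {C : ℝ} (hC : ∀ x, ‖Ψ x‖ ≤ C) :
    HasSum (fun k => ∫ x, B (F k x) (Ψ x) ∂m) (∫ x, B (S x) (Ψ x) ∂m) := by
  have hi := fun k => integrable_bilin_of_bound B (hF k) hΨ hC
  have h := hasSum_integral_of_summable_integral_norm hi ?_
  · convert h using 1
    refine integral_congr_ae ?_
    filter_upwards [hS] with x hx
    exact ((hx.mapL (B.flip (Ψ x))).tsum_eq).symm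
  · have hC' : ∀ x, ‖Ψ x‖ ≤ |C| := fun x => (hC x).trans (le_abs_self C)
    refine Summable.of_nonneg_of_le (fun k => integral_nonneg fun x => norm_nonneg _)
      (fun k => ?_) (hc.mul_left (‖B‖ * |C|))
    calc ∫ x, ‖B (F k x) (Ψ x)‖ ∂m ≤ ∫ x, ‖B‖ * |C| * ‖F k x‖ ∂m := by
          refine integral_mono (hi k).norm ((hF k).norm.const_mul _) fun x => ?_
          calc ‖B (F k x) (Ψ x)‖ ≤ ‖B‖ * ‖F k x‖ * ‖Ψ x‖ := B.le_opNorm₂ _ _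
            _ ≤ ‖B‖ * ‖F k x‖ * |C| := by gcongr; exact hC' x
            _ = ‖B‖ * |C| * ‖F k x‖ := by ring
      _ = ‖B‖ * |C| * ∫ x, ‖F k x‖ ∂m := integral_const_mul _ _
      _ ≤ ‖B‖ * |C| * c k := by gcongr; exact hle k

end Series

/-! ### Mollification of vector measures -/

section Mollification

variable {V W Z : Type*} [NormedAddCommGroup V] [NormedSpace ℝ V]
  [NormedAddCommGroup W] [NormedSpace ℝ W] [NormedAddCommGroup Z] [NormedSpace ℝ Z]

/-- The mollification `x ↦ ∫ ρ(x - y) F(y) dm(y)` of the vector measure `F m`. -/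
def mollify (ρ : ContDiffBump (0 : Vec d)) (m : Measure (Vec d)) (F : Vec d → V) (x : Vec d) : V :=
  ∫ y, ρ.normed volume (x - y) • F y ∂m

variable (ρ : ContDiffBump (0 : Vec d)) {m : Measure (Vec d)}

theorem integrable_bump_smul {F : Vec d → V} (hF : Integrable F m) (x : Vec d) :
    Integrable (fun y => ρ.normed volume (x - y) • F y) m := by
  obtain ⟨C, hC⟩ := ρ.hasCompactSupport_normed.exists_bound_of_continuous
    (ρ.continuous_normed (μ := volume))
  exact hF.bdd_smul C (ρ.continuous_normed.comp
    (continuous_const.sub continuous_id)).aestronglyMeasurable (Eventually.of_forall fun y => hC _)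

theorem mollify_sub {F G : Vec d → V} (hF : Integrable F m) (hG : Integrable G m) :
    mollify ρ m (fun x => F x - G x) = fun x => mollify ρ m F x - mollify ρ m G x := by
  ext x
  simp only [mollify, smul_sub]
  exact integral_sub (integrable_bump_smul ρ hF x) (integrable_bump_smul ρ hG x)

variable [SFinite m]

theorem integral_bump_sub_right (y : Vec d) :
    ∫ x, ρ.normed volume (x - y) = 1 := by
  rw [integral_sub_right_eq_self, ρ.integral_normed]

theorem integrable_prod_mollify {F : Vec d → V} (hF : Integrable F m) :
    Integrable (fun p : Vec d × Vec d => ρ.normed volume (p.1 - p.2) • F p.2)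
      (volume.prod m) := by
  have hmeas : AEStronglyMeasurable
      (fun p : Vec d × Vec d => ρ.normed volume (p.1 - p.2) • F p.2) (volume.prod m) :=
    (ρ.continuous_normed.comp
      (continuous_fst.sub continuous_snd)).aestronglyMeasurable.smul hF.1.comp_snd
  have hr : ∀ y, Integrable (fun x => ρ.normed volume (x - y) • F y) volume := fun y =>
    ((ρ.integrable_normed (μ := volume)).comp_sub_right y).smul_const (F y)
  rw [integrable_prod_iff' hmeas]
  refine ⟨Eventually.of_forall hr, ?_⟩
  simp only [norm_smul, Real.norm_of_nonneg (ρ.nonneg_normed _), integral_mul_const,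
    integral_bump_sub_right, one_mul]
  exact hF.norm

theorem integrable_mollify {F : Vec d → V} (hF : Integrable F m) :
    Integrable (mollify ρ m F) volume := (integrable_prod_mollify ρ hF).integral_prod_left

theorem integral_norm_mollify_le {F : Vec d → V} (hF : Integrable F m) :
    ∫ x, ‖mollify ρ m F x‖ ≤ ∫ y, ‖F y‖ ∂m := by
  have hp := integrable_prod_mollify ρ hF
  calc ∫ x, ‖mollify ρ m F x‖ ≤ ∫ x, ∫ y, ‖ρ.normed volume (x - y) • F y‖ ∂m :=
        integral_mono (integrable_mollify ρ hF).norm hp.norm.integral_prod_left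
          fun x => norm_integral_le_integral_norm _
    _ = ∫ y, ∫ x, ‖ρ.normed volume (x - y) • F y‖ ∂volume ∂m := integral_integral_swap hp.norm
    _ = _ := by
        simp only [norm_smul, Real.norm_of_nonneg (ρ.nonneg_normed _), integral_mul_const,
          integral_bump_sub_right, one_mul]

/-- Fubini and the evenness of the bump: mollification is self-adjoint, and can be moved onto the
test field. -/
theorem integral_bilin_mollify [CompleteSpace V] [CompleteSpace W] [CompleteSpace Z]
    (B : V →L[ℝ] W →L[ℝ] Z) {F : Vec d → V} (hF : Integrable F m)
    {Ψ : Vec d → W} (hΨ : Continuous Ψ) {C : ℝ} (hC : ∀ x, ‖Ψ x‖ ≤ C) :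
    ∫ x, B (mollify ρ m F x) (Ψ x) = ∫ y, B (F y) (mollify ρ volume Ψ y) ∂m := by
  have hp := integrable_bilin_of_bound B (integrable_prod_mollify ρ hF)
    (Ψ := fun p => Ψ p.1) (hΨ.comp continuous_fst).aestronglyMeasurable fun p => hC p.1
  have h1 : ∀ x, B (mollify ρ m F x) (Ψ x) = ∫ y, B (ρ.normed volume (x - y) • F y) (Ψ x) ∂m :=
    fun x => by
      rw [mollify]
      exact (((B.flip (Ψ x)).integral_comp_comm (integrable_bump_smul ρ hF x))).symm
  have hb : ∀ y, Integrable (fun x => ρ.normed volume (y - x) • Ψ x) volume := fun y =>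
    ((ρ.integrable_normed (μ := volume)).comp_sub_left y).smul_bdd C
      hΨ.aestronglyMeasurable (Eventually.of_forall hC)
  simp only [h1]
  rw [integral_integral_swap hp]
  refine integral_congr_ae (Eventually.of_forall fun y => ?_)
  simp only [mollify]
  rw [← (B (F y)).integral_comp_comm (hb y)]
  refine integral_congr_ae (Eventually.of_forall fun x => ?_)
  simp only [map_smul, smul_apply]
  rw [← ρ.normed_neg, neg_sub]

theorem mollify_eq_convolution (ψ : Vec d → V) :
    mollify ρ volume ψ = convolution (ρ.normed volume) ψ (ContinuousLinearMap.lsmul ℝ ℝ) volume := by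
  ext x
  rw [convolution_lsmul_swap]
  rfl

theorem contDiff_mollify {ψ : Vec d → V} (hψ : ContDiff ℝ ∞ ψ) (hc : HasCompactSupport ψ) :
    ContDiff ℝ ∞ (mollify ρ volume ψ) := by
  rw [mollify_eq_convolution]
  exact hc.contDiff_convolution_right _ ρ.integrable_normed.locallyIntegrable hψ

theorem fderiv_mollify {ψ : Vec d → ℝ} (hψ : ContDiff ℝ ∞ ψ) (hc : HasCompactSupport ψ)
    (x : Vec d) : fderiv ℝ (mollify ρ volume ψ) x = mollify ρ volume (fderiv ℝ ψ) x := by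
  rw [mollify_eq_convolution]
  rw [(hc.hasFDerivAt_convolution_right _ ρ.integrable_normed.locallyIntegrable
    (hψ.of_le (by norm_num)) x).fderiv, mollify_eq_convolution]
  rfl

theorem norm_mollify_sub_le [CompleteSpace V] {ψ : Vec d → V} (hψ : Continuous ψ) {x : Vec d} {τ : ℝ}
    (h : ∀ y, dist y x < ρ.rOut → ‖ψ y - ψ x‖ ≤ τ) : ‖mollify ρ volume ψ x - ψ x‖ ≤ τ := by
  rw [mollify_eq_convolution, ← dist_eq_norm]
  exact ρ.dist_normed_convolution_le hψ.aestronglyMeasurable fun y hy => by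
    rw [dist_eq_norm]; exact h y hy

theorem norm_mollify_le {ψ : Vec d → V} {C : ℝ} (hC : ∀ x, ‖ψ x‖ ≤ C) (x : Vec d) :
    ‖mollify ρ volume ψ x‖ ≤ C := by
  have h1 : Integrable (fun y => ρ.normed volume (x - y)) volume :=
    (ρ.integrable_normed (μ := volume)).comp_sub_left x
  calc ‖mollify ρ volume ψ x‖ ≤ ∫ y, ρ.normed volume (x - y) * C :=
        norm_integral_le_of_norm_le (h1.mul_const C) (Eventually.of_forall fun y => by
          rw [norm_smul, Real.norm_of_nonneg (ρ.nonneg_normed _)]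
          exact mul_le_mul_of_nonneg_left (hC y) (ρ.nonneg_normed _))
    _ = C := by
        rw [integral_mul_const, integral_sub_left_eq_self (fun y => ρ.normed volume y) volume x,
          ρ.integral_normed, one_mul]

/-- Mollification converges in `L¹`. -/
theorem exists_integral_norm_mollify_sub_le [CompleteSpace V] {g : Vec d → V} (hg : Integrable g volume) {η : ℝ}
    (hη : 0 < η) : ∃ ε > 0, ∀ ρ : ContDiffBump (0 : Vec d), ρ.rOut ≤ ε →
      ∫ x, ‖mollify ρ volume g x - g x‖ ≤ η := by
  obtain ⟨k, hkc, hk1, hk2, hk3⟩ := hg.exists_hasCompactSupport_integral_sub_le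
    (show 0 < η / 3 by positivity)
  -- Radii are kept at most 1, so `K` contains the supports of `k` and of all its mollifications.
  -- There the error is at most `τ`, chosen to integrate to at most `η / 3`.
  set K := Metric.cthickening 1 (tsupport k) with hK
  have hKc : IsCompact K := hkc.isCompact.cthickening
  have hv : 0 ≤ volume.real K := measureReal_nonneg
  set τ := η / 3 / (volume.real K + 1) with hτ
  have hτ0 : 0 < τ := by positivity
  obtain ⟨ε, hε, hk4⟩ := Metric.uniformContinuous_iff.1
    (hkc.uniformContinuous_of_continuous hk2) τ hτ0
  refine ⟨min ε 1, lt_min hε one_pos, fun ρ hρ => ?_⟩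
  have hb : ∀ x, ‖mollify ρ volume k x - k x‖ ≤ K.indicator (fun _ => τ) x := by
    intro x
    by_cases hx : x ∈ K
    · rw [Set.indicator_of_mem hx]
      refine norm_mollify_sub_le ρ hk2 fun y hy => ?_
      rw [← dist_eq_norm]
      exact (hk4 (hy.trans_le (hρ.trans (min_le_left _ _)))).le
    · rw [Set.indicator_of_notMem hx]
      have h0 : ∀ y, dist y x < ρ.rOut → k y = 0 := fun y hy => by
        by_contra hne
        refine hx (Metric.mem_cthickening_of_dist_le x y 1 _ (subset_closure hne) ?_)
        rw [dist_comm]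
        exact (hy.trans_le (hρ.trans (min_le_right _ _))).le
      refine norm_mollify_sub_le ρ hk2 fun y hy => ?_
      rw [h0 y hy, h0 x (by simpa using ρ.rOut_pos)]
      simp
  have hI : Integrable (K.indicator fun _ => τ) (volume : Measure (Vec d)) :=
    (integrable_indicator_iff hKc.isClosed.measurableSet).2
      (integrableOn_const hKc.measure_lt_top.ne)
  have h1 : ∫ x, ‖mollify ρ volume k x - k x‖ ≤ η / 3 := by
    calc _ ≤ ∫ x, K.indicator (fun _ => τ) x :=
          integral_mono ((integrable_mollify ρ hk3).sub hk3).norm hI hb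
      _ = volume.real K * τ := by
          rw [integral_indicator_const _ hKc.isClosed.measurableSet, smul_eq_mul]
      _ ≤ (volume.real K + 1) * τ := by gcongr; linarith
      _ = η / 3 := by rw [hτ]; field_simp
  have h2 : ∫ x, ‖mollify ρ volume (fun x => g x - k x) x‖ ≤ η / 3 :=
    (integral_norm_mollify_le ρ (hg.sub hk3)).trans hk1
  have i1 : Integrable (fun x => ‖mollify ρ volume (fun x => g x - k x) x‖) volume :=
    (integrable_mollify ρ (hg.sub hk3)).norm
  have i2 : Integrable (fun x => ‖mollify ρ volume k x - k x‖) volume :=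
    ((integrable_mollify ρ hk3).sub hk3).norm
  have i3 : Integrable (fun x => ‖g x - k x‖) volume := (hg.sub hk3).norm
  calc ∫ x, ‖mollify ρ volume g x - g x‖
      ≤ ∫ x, (‖mollify ρ volume (fun x => g x - k x) x‖ + ‖mollify ρ volume k x - k x‖
          + ‖g x - k x‖) := by
        refine integral_mono ((integrable_mollify ρ hg).sub hg).norm ((i1.add i2).add i3)
          fun x => ?_
        rw [mollify_sub ρ hg hk3]
        have : mollify ρ volume g x - g x = (mollify ρ volume g x - mollify ρ volume k x)
            + (mollify ρ volume k x - k x) - (g x - k x) := by abel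
        simp only [this]
        exact (norm_sub_le _ _).trans (add_le_add_left (norm_add_le _ _) _)
    _ = (∫ x, ‖mollify ρ volume (fun x => g x - k x) x‖) +
          (∫ x, ‖mollify ρ volume k x - k x‖) + ∫ x, ‖g x - k x‖ := by
        rw [← integral_add i1 i2]
        exact integral_add (i1.add i2) i3
    _ ≤ η / 3 + η / 3 + η / 3 := by gcongr
    _ = η := by ring

end Mollification


/-! ### The symmetrized product and the test identity in vector form -/

section SymmetricTensor

theorem SymMat.entry_ext {A B : SymMat d} (h : ∀ i j, A.entry i j = B.entry i j) : A = B :=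
  Subtype.ext (PiLp.ext fun p => h p.1 p.2)

theorem SymMat.entry_add (A B : SymMat d) (i j : Fin d) :
    (A + B).entry i j = A.entry i j + B.entry i j := rfl

theorem SymMat.entry_smul (c : ℝ) (A : SymMat d) (i j : Fin d) :
    (c • A).entry i j = c * A.entry i j := rfl

theorem SymMat.entry_neg (A : SymMat d) (i j : Fin d) : (-A).entry i j = -A.entry i j := rfl

/-- The `(i, j)` entry as a continuous linear form. -/
def entryCLM (i j : Fin d) : SymMat d →L[ℝ] ℝ :=
  LinearMap.toContinuousLinearMap
    { toFun := fun A => A.entry i j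
      map_add' := fun A B => A.entry_add B i j
      map_smul' := fun c A => A.entry_smul c i j }

theorem entryCLM_apply (i j : Fin d) (A : SymMat d) : entryCLM i j A = A.entry i j := rfl

/-- The symmetrized tensor product of a vector and a covector, as a function. -/
def symTensorFun (a : Vec d) (ℓ : Vec d →L[ℝ] ℝ) : SymMat d :=
  (⟨WithLp.toLp 2 fun p => (a p.1 * ℓ (EuclideanSpace.single p.2 1)
    + a p.2 * ℓ (EuclideanSpace.single p.1 1)) / 2, fun i j => by simp only; ring⟩ : symSubspace d)

theorem entry_symTensorFun (a : Vec d) (ℓ : Vec d →L[ℝ] ℝ) (i j : Fin d) :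
    (symTensorFun a ℓ).entry i j = (a i * ℓ (EuclideanSpace.single j 1)
      + a j * ℓ (EuclideanSpace.single i 1)) / 2 := rfl

/-- The symmetrized tensor product of a vector and a covector. -/
def symTensor (d : ℕ) : Vec d →L[ℝ] (Vec d →L[ℝ] ℝ) →L[ℝ] SymMat d :=
  LinearMap.toContinuousBilinearMap <| LinearMap.mk₂ ℝ symTensorFun
    (fun a b ℓ => SymMat.entry_ext fun i j => by
      simp only [SymMat.entry_add, entry_symTensorFun, PiLp.add_apply]; ring)
    (fun c a ℓ => SymMat.entry_ext fun i j => by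
      simp only [SymMat.entry_smul, entry_symTensorFun, PiLp.smul_apply, smul_eq_mul]; ring)
    (fun a ℓ m => SymMat.entry_ext fun i j => by
      simp only [SymMat.entry_add, entry_symTensorFun, add_apply]; ring)
    (fun c a ℓ => SymMat.entry_ext fun i j => by
      simp only [SymMat.entry_smul, entry_symTensorFun, smul_apply, smul_eq_mul]; ring)

theorem entry_symTensor (a : Vec d) (ℓ : Vec d →L[ℝ] ℝ) (i j : Fin d) :
    (symTensor d a ℓ).entry i j = (a i * ℓ (EuclideanSpace.single j 1)
      + a j * ℓ (EuclideanSpace.single i 1)) / 2 := rfl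

variable {Ω : Set (Vec d)} {u : Lp (Vec d) 1 (volume.restrict Ω)}

theorem integrable_indicator_Lp (hΩ : MeasurableSet Ω) (u : Lp (Vec d) 1 (volume.restrict Ω)) :
    Integrable (Ω.indicator u) volume :=
  (integrable_indicator_iff hΩ).2 (L1.integrable_coeFn u)

theorem exists_bound_fderiv {φ : Vec d → ℝ} (h1 : ContDiff ℝ ∞ φ) (h2 : HasCompactSupport φ) :
    Continuous (fderiv ℝ φ) ∧ ∃ C, ∀ x, ‖fderiv ℝ φ x‖ ≤ C := by
  have h : Continuous (fderiv ℝ φ) := h1.continuous_fderiv (by simp)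
  exact ⟨h, h2.fderiv (𝕜 := ℝ) |>.exists_bound_of_continuous h⟩

/-- The entries of the test identity for the symmetrized derivative. -/
theorem entry_integral_symTensor (hΩ : MeasurableSet Ω) (u : Lp (Vec d) 1 (volume.restrict Ω))
    {φ : Vec d → ℝ} (h1 : ContDiff ℝ ∞ φ) (h2 : HasCompactSupport φ) (i j : Fin d) :
    (∫ x, symTensor d (Ω.indicator u x) (fderiv ℝ φ x)).entry i j
      = ∫ x in Ω, (u x i * fderiv ℝ φ x (EuclideanSpace.single j 1)
          + u x j * fderiv ℝ φ x (EuclideanSpace.single i 1)) / 2 := by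
  obtain ⟨hc, C, hC⟩ := exists_bound_fderiv h1 h2
  rw [← entryCLM_apply, ← (entryCLM i j).integral_comp_comm (integrable_bilin_of_bound _
    (integrable_indicator_Lp hΩ u) hc.aestronglyMeasurable hC), ← integral_indicator hΩ]
  refine integral_congr_ae (Eventually.of_forall fun x => ?_)
  simp only [entryCLM_apply, entry_symTensor]
  by_cases hx : x ∈ Ω
  · simp [hx]
  · simp [hx]

theorem IsSymDeriv.integral_symTensor {μ : VectorMeasure (Vec d) (SymMat d)}
    (hu : IsSymDeriv Ω u μ) (hΩ : MeasurableSet Ω) {φ : Vec d → ℝ} (h1 : ContDiff ℝ ∞ φ)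
    (h2 : HasCompactSupport φ) (h3 : tsupport φ ⊆ Ω) :
    ∫ x, symTensor d (Ω.indicator u x) (fderiv ℝ φ x) = -∫ᵛ x, φ x ∂•μ :=
  SymMat.entry_ext fun i j => by
    rw [entry_integral_symTensor hΩ u h1 h2, hu.integral_eq φ h1 h2 h3, SymMat.entry_neg]

end SymmetricTensor

/-- Smooth partitions of unity on open sets, without local finiteness. -/
theorem exists_smooth_partition {Ω : Set (Vec d)} (hΩ : IsOpen Ω) :
    ∃ φ : ℕ → Vec d → ℝ, (∀ k, ContDiff ℝ ∞ (φ k)) ∧ (∀ k, HasCompactSupport (φ k)) ∧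
      (∀ k, tsupport (φ k) ⊆ Ω) ∧ (∀ k x, 0 ≤ φ k x) ∧ ∀ x ∈ Ω, HasSum (fun k => φ k x) 1 := by
  obtain ⟨ψ, h1, h2, h3, h4, h5⟩ := exists_cutoff hΩ
  have hsq : ∀ n x, 0 ≤ 1 - ψ n x ^ 2 := fun n x => by
    rw [sub_nonneg, sq_le_one_iff_abs_le_one]; exact h4 n x
  have hsupp : ∀ k, Function.support (fun x => ψ k x ^ 2 * ∏ j ∈ Finset.range k, (1 - ψ j x ^ 2))
      ⊆ Function.support (ψ k) := fun k x hx h0 => hx (by simp [h0])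
  -- The sums telescope to `1 - ∏ (1 - ψ_j²)`. The product is at most its last factor, which tends
  -- to zero on `Ω`. Squares are used since the cut-offs may be negative.
  refine ⟨fun k x => ψ k x ^ 2 * ∏ j ∈ Finset.range k, (1 - ψ j x ^ 2), fun k => ?_, fun k => ?_,
    fun k => ?_, fun k x => ?_, fun x hx => ?_⟩
  · exact ((h1 k).pow 2).mul (contDiff_prod fun j _ => contDiff_const.sub ((h1 j).pow 2))
  · exact (h2 k).mono (hsupp k)
  · exact (closure_mono (hsupp k)).trans (h3 k)
  · exact mul_nonneg (sq_nonneg _) (Finset.prod_nonneg fun j _ => hsq j x)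
  · rw [hasSum_iff_tendsto_nat_of_nonneg fun k =>
      mul_nonneg (sq_nonneg _) (Finset.prod_nonneg fun j _ => hsq j x)]
    have hpart : ∀ n, ∑ k ∈ Finset.range n, ψ k x ^ 2 * ∏ j ∈ Finset.range k, (1 - ψ j x ^ 2)
        = 1 - ∏ j ∈ Finset.range n, (1 - ψ j x ^ 2) := fun n => by
      induction n with
      | zero => simp
      | succ n ih => rw [Finset.sum_range_succ, ih, Finset.prod_range_succ]; ring
    simp only [hpart]
    suffices h : Tendsto (fun n => ∏ j ∈ Finset.range n, (1 - ψ j x ^ 2)) atTop (𝓝 0) by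
      simpa using h.const_sub 1
    rw [← tendsto_add_atTop_iff_nat 1]
    have hx1 := h5 x
    rw [Set.indicator_of_mem hx] at hx1
    have hlim : Tendsto (fun n => 1 - ψ n x ^ 2) atTop (𝓝 0) := by
      simpa using (hx1.pow 2).const_sub 1
    refine squeeze_zero (fun n => Finset.prod_nonneg fun j _ => hsq j x) (fun n => ?_) hlim
    rw [Finset.prod_range_succ]
    refine mul_le_of_le_one_left (hsq n x) (Finset.prod_le_one (fun j _ => hsq j x) fun j _ => ?_)
    linarith [sq_nonneg (ψ j x)]


/-! ### One term of the approximation: mollifying `φ u` -/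

/-- The field `(-φ, u ⊙ ∇φ)`. -/
def cutoffField (Ω : Set (Vec d)) (u : Vec d → Vec d) (φ : Vec d → ℝ) (x : Vec d) : LiftVec d :=
  WithLp.toLp 2 (-φ x, symTensor d (Ω.indicator u x) (fderiv ℝ φ x))

/-- The lift of the symmetrized derivative of the mollification of `φ u`, corrected by the
mollification error of `(-φ, u ⊙ ∇φ)`. -/
def mollifiedLift (ρ : ContDiffBump (0 : Vec d)) (Ω : Set (Vec d)) (u : Vec d → Vec d)
    (μ : VectorMeasure (Vec d) (SymMat d)) (φ : Vec d → ℝ) (x : Vec d) : LiftVec d :=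
  mollify ρ (liftMeasure Ω μ) (fun y => φ y • liftField μ y) x
    + (mollify ρ volume (cutoffField Ω u φ) x - cutoffField Ω u φ x)

section LocalApproximation

variable {Ω : Set (Vec d)} {μ : VectorMeasure (Vec d) (SymMat d)}

theorem integrable_smul_liftField [IsFiniteMeasure μ.variation] (hvol : volume Ω ≠ ⊤)
    {φ : Vec d → ℝ} (h1 : Continuous φ) {C : ℝ} (hC : ∀ x, ‖φ x‖ ≤ C) :
    Integrable (fun y => φ y • liftField μ y) (liftMeasure Ω μ) := by
  have := isFiniteMeasure_liftMeasure (μ := μ) hvol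
  refine Integrable.of_bound (h1.aestronglyMeasurable.smul
    measurable_liftField.aestronglyMeasurable) C ?_
  filter_upwards [norm_liftField (Ω := Ω) (μ := μ)] with x hx
  rw [norm_smul, hx, mul_one]
  exact hC x

theorem integrable_cutoffField (hΩ : MeasurableSet Ω) (u : Lp (Vec d) 1 (volume.restrict Ω))
    {φ : Vec d → ℝ} (h1 : ContDiff ℝ ∞ φ) (h2 : HasCompactSupport φ) :
    Integrable (cutoffField Ω u φ) volume := by
  obtain ⟨hc, C, hC⟩ := exists_bound_fderiv h1 h2
  have h3 := (h1.continuous.integrable_of_hasCompactSupport (μ := volume) h2).neg.prodMk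
    (integrable_bilin_of_bound (symTensor d) (integrable_indicator_Lp hΩ u)
      hc.aestronglyMeasurable hC)
  exact (WithLp.prodContinuousLinearEquiv 2 ℝ ℝ (SymMat d)).symm.toContinuousLinearMap.integrable_comp
    h3

variable (ρ : ContDiffBump (0 : Vec d)) {φ : Vec d → ℝ}

theorem integrable_mollifiedLift [IsFiniteMeasure μ.variation] (hΩ : MeasurableSet Ω)
    (hvol : volume Ω ≠ ⊤) (u : Lp (Vec d) 1 (volume.restrict Ω)) (h1 : ContDiff ℝ ∞ φ)
    (h2 : HasCompactSupport φ) : Integrable (mollifiedLift ρ Ω u μ φ) volume := by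
  have := isFiniteMeasure_liftMeasure (μ := μ) hvol
  obtain ⟨C, hC⟩ := h2.exists_bound_of_continuous h1.continuous
  exact (integrable_mollify ρ (integrable_smul_liftField hvol h1.continuous hC)).add
    ((integrable_mollify ρ (integrable_cutoffField hΩ u h1 h2)).sub
      (integrable_cutoffField hΩ u h1 h2))

theorem integral_norm_mollifiedLift_le [IsFiniteMeasure μ.variation] (hΩ : MeasurableSet Ω)
    (hvol : volume Ω ≠ ⊤) (u : Lp (Vec d) 1 (volume.restrict Ω)) (h1 : ContDiff ℝ ∞ φ)
    (h2 : HasCompactSupport φ) (h0 : ∀ x, 0 ≤ φ x) {η : ℝ}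
    (hη : ∫ x, ‖mollify ρ volume (cutoffField Ω u φ) x - cutoffField Ω u φ x‖ ≤ η) :
    ∫ x, ‖mollifiedLift ρ Ω u μ φ x‖ ≤ (∫ x, φ x ∂(liftMeasure Ω μ)) + η := by
  have := isFiniteMeasure_liftMeasure (μ := μ) hvol
  obtain ⟨C, hC⟩ := h2.exists_bound_of_continuous h1.continuous
  have i1 := integrable_smul_liftField (Ω := Ω) (μ := μ) hvol h1.continuous hC
  have i2 := integrable_cutoffField hΩ u h1 h2
  have i3 := (integrable_mollify ρ i2).sub i2
  calc ∫ x, ‖mollifiedLift ρ Ω u μ φ x‖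
      ≤ ∫ x, (‖mollify ρ (liftMeasure Ω μ) (fun y => φ y • liftField μ y) x‖
          + ‖mollify ρ volume (cutoffField Ω u φ) x - cutoffField Ω u φ x‖) :=
        integral_mono (integrable_mollifiedLift ρ hΩ hvol u h1 h2).norm
          ((integrable_mollify ρ i1).norm.add i3.norm) fun x => norm_add_le _ _
    _ = (∫ x, ‖mollify ρ (liftMeasure Ω μ) (fun y => φ y • liftField μ y) x‖)
          + ∫ x, ‖mollify ρ volume (cutoffField Ω u φ) x - cutoffField Ω u φ x‖ :=
        integral_add (integrable_mollify ρ i1).norm i3.norm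
    _ ≤ (∫ x, ‖φ x • liftField μ x‖ ∂(liftMeasure Ω μ)) + η :=
        add_le_add (integral_norm_mollify_le ρ i1) hη
    _ = _ := by
        congr 1
        refine integral_congr_ae ?_
        filter_upwards [norm_liftField (Ω := Ω) (μ := μ)] with x hx
        rw [norm_smul, hx, mul_one, Real.norm_of_nonneg (h0 x)]

/-- The mollification of `φ dx` cancels against that of the entry `-φ` of `cutoffField`, and
subtracting `-φ` leaves `φ` itself. This exactness makes the first coordinates of the terms add up
to 1. -/
theorem fst_mollifiedLift [IsFiniteMeasure μ.variation] (hΩ : MeasurableSet Ω)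
    (hvol : volume Ω ≠ ⊤) (hμ : μ.variation Ωᶜ = 0) (u : Lp (Vec d) 1 (volume.restrict Ω))
    (h1 : ContDiff ℝ ∞ φ) (h2 : HasCompactSupport φ) (h3 : tsupport φ ⊆ Ω) (x : Vec d) :
    (mollifiedLift ρ Ω u μ φ x).fst = φ x := by
  obtain ⟨C, hC⟩ := h2.exists_bound_of_continuous h1.continuous
  obtain ⟨C', hC'⟩ := ρ.hasCompactSupport_normed.exists_bound_of_continuous
    (ρ.continuous_normed (μ := volume))
  have hk : Continuous fun y => ρ.normed volume (x - y) * φ y :=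
    (ρ.continuous_normed.comp (continuous_const.sub continuous_id)).mul h1.continuous
  have e1 : mollify ρ (liftMeasure Ω μ) (fun y => φ y • liftField μ y) x
      = WithLp.toLp 2 (∫ y in Ω, ρ.normed volume (x - y) * φ y,
        ∫ᵛ y, ρ.normed volume (x - y) * φ y ∂•μ) := by
    rw [← integral_smul_liftField hΩ hvol hμ hk.stronglyMeasurable (C := C' * C) fun y => ?_]
    · simp only [mollify, smul_smul]
    · rw [norm_mul]
      exact mul_le_mul (hC' _) (hC _) (norm_nonneg _) ((norm_nonneg _).trans (hC' 0))
  have e2 : ∫ y in Ω, ρ.normed volume (x - y) * φ y = ∫ y, ρ.normed volume (x - y) * φ y :=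
    setIntegral_eq_integral_of_forall_compl_eq_zero fun y hy => by
      rw [image_eq_zero_of_notMem_tsupport fun h => hy (h3 h), mul_zero]
  have e3 : (mollify ρ volume (cutoffField Ω u φ) x).fst
      = -∫ y, ρ.normed volume (x - y) * φ y := by
    rw [← WithLp.fstL_apply (𝕜 := ℝ), mollify, ← ContinuousLinearMap.integral_comp_comm _
      (integrable_bump_smul ρ (integrable_cutoffField hΩ u h1 h2) x), ← integral_neg]
    simp [cutoffField]
  rw [mollifiedLift, e1, e2, WithLp.add_fst, WithLp.sub_fst, e3]
  simp [cutoffField]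

/-- Duality formula for the approximating field. -/
theorem integral_smul_mollifiedLift [IsFiniteMeasure μ.variation] (hΩ : MeasurableSet Ω)
    (hvol : volume Ω ≠ ⊤) (u : Lp (Vec d) 1 (volume.restrict Ω)) (h1 : ContDiff ℝ ∞ φ)
    (h2 : HasCompactSupport φ) {ψ : Vec d → ℝ} (hψ : Continuous ψ) {C : ℝ}
    (hC : ∀ x, ‖ψ x‖ ≤ C) :
    ∫ x, ψ x • mollifiedLift ρ Ω u μ φ x
      = (∫ x, mollify ρ volume ψ x • φ x • liftField μ x ∂(liftMeasure Ω μ))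
        + ∫ x, ψ x • (mollify ρ volume (cutoffField Ω u φ) x - cutoffField Ω u φ x) := by
  have := isFiniteMeasure_liftMeasure (μ := μ) hvol
  obtain ⟨C', hC'⟩ := h2.exists_bound_of_continuous h1.continuous
  have i1 := integrable_smul_liftField (Ω := Ω) (μ := μ) hvol h1.continuous hC'
  have i2 := integrable_cutoffField hΩ u h1 h2
  have i3 := (integrable_mollify ρ i2).sub i2
  have h := integral_bilin_mollify ρ (ContinuousLinearMap.lsmul ℝ ℝ).flip i1 hψ hC
  simp only [ContinuousLinearMap.flip_apply, ContinuousLinearMap.lsmul_apply] at h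
  rw [← h]
  simp only [mollifiedLift, smul_add]
  exact integral_add (integrable_bilin_of_bound (ContinuousLinearMap.lsmul ℝ ℝ).flip
      (integrable_mollify ρ i1) hψ.aestronglyMeasurable hC)
    (integrable_bilin_of_bound (ContinuousLinearMap.lsmul ℝ ℝ).flip i3 hψ.aestronglyMeasurable hC)

theorem integral_bilin_mollify_sub {V W Z : Type*} [NormedAddCommGroup V] [NormedSpace ℝ V]
    [NormedAddCommGroup W] [NormedSpace ℝ W] [NormedAddCommGroup Z] [NormedSpace ℝ Z]
    [CompleteSpace V] [CompleteSpace W] [CompleteSpace Z] (B : V →L[ℝ] W →L[ℝ] Z)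
    {F : Vec d → V} (hF : Integrable F volume) {Ψ : Vec d → W} (hΨ : Continuous Ψ)
    (hm : AEStronglyMeasurable (mollify ρ volume Ψ) volume)
    {C : ℝ} (hC : ∀ x, ‖Ψ x‖ ≤ C) :
    ∫ x, B (mollify ρ volume F x - F x) (Ψ x) = ∫ x, B (F x) (mollify ρ volume Ψ x - Ψ x) := by
  simp only [map_sub, sub_apply]
  rw [integral_sub (integrable_bilin_of_bound B (integrable_mollify ρ hF) hΨ.aestronglyMeasurable hC)
    (integrable_bilin_of_bound B hF hΨ.aestronglyMeasurable hC), integral_sub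
    (integrable_bilin_of_bound B hF hm (norm_mollify_le ρ hC))
    (integrable_bilin_of_bound B hF hΨ.aestronglyMeasurable hC), integral_bilin_mollify ρ B hF hΨ hC]

theorem integrable_indicator_smul (hΩ : MeasurableSet Ω) (u : Lp (Vec d) 1 (volume.restrict Ω))
    (h1 : Continuous φ) (h2 : HasCompactSupport φ) :
    Integrable (fun y => φ y • Ω.indicator u y) volume := by
  obtain ⟨C, hC⟩ := h2.exists_bound_of_continuous h1
  exact (integrable_indicator_Lp hΩ u).bdd_smul C h1.aestronglyMeasurable (Eventually.of_forall hC)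

theorem snd_integral_smul_cutoffField (hΩ : MeasurableSet Ω)
    (u : Lp (Vec d) 1 (volume.restrict Ω)) (h1 : ContDiff ℝ ∞ φ) (h2 : HasCompactSupport φ)
    {θ : Vec d → ℝ} (hθ : Continuous θ) {C : ℝ} (hC : ∀ x, ‖θ x‖ ≤ C) :
    (∫ x, θ x • cutoffField Ω u φ x).snd
      = ∫ x, θ x • symTensor d (Ω.indicator u x) (fderiv ℝ φ x) := by
  have i : Integrable (fun x => θ x • cutoffField Ω u φ x) volume :=
    (integrable_cutoffField hΩ u h1 h2).bdd_smul C hθ.aestronglyMeasurable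
      (Eventually.of_forall hC)
  rw [← WithLp.sndL_apply (𝕜 := ℝ), ← ContinuousLinearMap.integral_comp_comm _ i]
  simp [cutoffField]

/-- The test identity for a product of test functions. -/
theorem integral_symTensor_smul {u : Lp (Vec d) 1 (volume.restrict Ω)}
    (hu : IsSymDeriv Ω u μ) (hΩ : MeasurableSet Ω)
    (hvol : volume Ω ≠ ⊤) (h1 : ContDiff ℝ ∞ φ)
    (h2 : HasCompactSupport φ) (h3 : tsupport φ ⊆ Ω) {θ : Vec d → ℝ} (hθs : ContDiff ℝ ∞ θ)
    {C D : ℝ} (hθC : ∀ x, ‖θ x‖ ≤ C) (hθD : ∀ x, ‖fderiv ℝ θ x‖ ≤ D) :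
    ∫ x, symTensor d (φ x • Ω.indicator u x) (fderiv ℝ θ x)
      = -(∫ x, θ x • φ x • liftField μ x ∂(liftMeasure Ω μ)).snd
        - (∫ x, θ x • cutoffField Ω u φ x).snd := by
  have := hu.finite
  obtain ⟨C', hC'⟩ := h2.exists_bound_of_continuous h1.continuous
  obtain ⟨hd', D', hD'⟩ := exists_bound_fderiv h1 h2
  have hθdc : Continuous (fderiv ℝ θ) := hθs.continuous_fderiv (by simp)
  have iU := integrable_indicator_Lp hΩ u
  -- The factor `φ` alone puts the support inside `Ω`, so `θ` need only be bounded with bounded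
  -- gradient; the formula is the product rule applied to `φ θ`.
  have hT := hu.integral_symTensor hΩ (φ := fun x => φ x * θ x) (h1.mul hθs) h2.mul_right
    (tsupport_mul_subset_left.trans h3)
  have hprod : ∀ x, symTensor d (Ω.indicator u x) (fderiv ℝ (fun x => φ x * θ x) x)
      = symTensor d (φ x • Ω.indicator u x) (fderiv ℝ θ x)
        + θ x • symTensor d (Ω.indicator u x) (fderiv ℝ φ x) := fun x => by
    rw [fderiv_fun_mul (h1.differentiable (by simp) x) (hθs.differentiable (by simp) x)]
    simp only [map_add, map_smul, smul_apply]
  simp only [hprod] at hT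
  have iG := integrable_bilin_of_bound (symTensor d) iU hd'.aestronglyMeasurable hD'
  have iθG : Integrable (fun x => θ x • symTensor d (Ω.indicator u x) (fderiv ℝ φ x)) volume :=
    iG.bdd_smul C hθs.continuous.aestronglyMeasurable (Eventually.of_forall hθC)
  rw [integral_add (integrable_bilin_of_bound (symTensor d)
    (integrable_indicator_smul hΩ u h1.continuous h2) hθdc.aestronglyMeasurable hθD) iθG] at hT
  have hv := integral_smul_liftField (Ω := Ω) hΩ hvol hu.carried (k := fun x => φ x * θ x)
    (h1.continuous.mul hθs.continuous).stronglyMeasurable (C := C' * C) fun x => by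
      rw [norm_mul]
      exact mul_le_mul (hC' _) (hθC _) (norm_nonneg _) ((norm_nonneg _).trans (hC' 0))
  simp only [smul_smul, mul_comm (θ _)]
  rw [snd_integral_smul_cutoffField hΩ u h1 h2 hθs.continuous hθC, hv]
  exact eq_sub_of_add_eq hT

/-- The symmetrized derivative of the mollification error of `φ u`. -/
theorem integral_symTensor_mollify_sub {u : Lp (Vec d) 1 (volume.restrict Ω)}
    (hu : IsSymDeriv Ω u μ) (hΩ : MeasurableSet Ω)
    (hvol : volume Ω ≠ ⊤) (h1 : ContDiff ℝ ∞ φ)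
    (h2 : HasCompactSupport φ) (h3 : tsupport φ ⊆ Ω) {ψ : Vec d → ℝ} (hψ : ContDiff ℝ ∞ ψ)
    (hψc : HasCompactSupport ψ) :
    ∫ x, symTensor d (mollify ρ volume (fun y => φ y • Ω.indicator u y) x
        - φ x • Ω.indicator u x) (fderiv ℝ ψ x)
      = (∫ x, ψ x • φ x • liftField μ x ∂(liftMeasure Ω μ)).snd
        - (∫ x, ψ x • mollifiedLift ρ Ω u μ φ x).snd := by
  have := hu.finite
  have hm := isFiniteMeasure_liftMeasure (μ := μ) hvol
  obtain ⟨C, hC⟩ := hψc.exists_bound_of_continuous hψ.continuous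
  obtain ⟨C', hC'⟩ := h2.exists_bound_of_continuous h1.continuous
  obtain ⟨hd, D, hD⟩ := exists_bound_fderiv hψ hψc
  have iν := integrable_smul_liftField (Ω := Ω) (μ := μ) hvol h1.continuous hC'
  have hmψ := contDiff_mollify ρ hψ hψc
  have hmd : mollify ρ volume (fderiv ℝ ψ) = fderiv ℝ (mollify ρ volume ψ) :=
    funext fun x => (fderiv_mollify ρ hψ hψc x).symm
  have hθd : ∀ x, mollify ρ volume (fderiv ℝ ψ) x - fderiv ℝ ψ x
      = fderiv ℝ (fun x => mollify ρ volume ψ x - ψ x) x := fun x => by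
    rw [hmd]
    exact (fderiv_fun_sub (hmψ.differentiable (by simp) x) (hψ.differentiable (by simp) x)).symm
  -- Self-adjointness moves the mollification error of `φ u` onto the test function, and the product
  -- identity is then applied with `θ = ρ * ψ - ψ`.
  have hL := integral_bilin_mollify_sub ρ (symTensor d)
    (integrable_indicator_smul hΩ u h1.continuous h2) hd
    (by rw [hmd]; exact (hmψ.continuous_fderiv (by simp)).aestronglyMeasurable) hD
  simp only [hθd] at hL
  have hT := integral_symTensor_smul hu hΩ hvol h1 h2 h3 (hmψ.sub hψ) (C := C + C) (D := D + D)
    (fun x => (norm_sub_le _ _).trans (add_le_add (norm_mollify_le ρ hC x) (hC x)))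
    (fun x => by
      rw [← hθd]
      exact (norm_sub_le _ _).trans (add_le_add (norm_mollify_le ρ hD x) (hD x)))
  -- The term with `∇φ` is moved back: the error of `ψ` against `cutoffField` becomes the error of
  -- `cutoffField` against `ψ`, which is the correction in `mollifiedLift`.
  have hR2 := integral_bilin_mollify_sub ρ (ContinuousLinearMap.lsmul ℝ ℝ).flip
    (integrable_cutoffField hΩ u h1 h2) hψ.continuous hmψ.continuous.aestronglyMeasurable hC
  simp only [ContinuousLinearMap.flip_apply, ContinuousLinearMap.lsmul_apply] at hR2
  have hR4 : ∫ x, (mollify ρ volume ψ x - ψ x) • φ x • liftField μ x ∂(liftMeasure Ω μ)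
      = (∫ x, mollify ρ volume ψ x • φ x • liftField μ x ∂(liftMeasure Ω μ))
        - ∫ x, ψ x • φ x • liftField μ x ∂(liftMeasure Ω μ) := by
    have j : ∀ g : Vec d → ℝ, Continuous g → (∀ x, ‖g x‖ ≤ C) →
        Integrable (fun x => g x • φ x • liftField μ x) (liftMeasure Ω μ) := fun g hg hgC =>
      integrable_bilin_of_bound (ContinuousLinearMap.lsmul ℝ ℝ).flip iν hg.aestronglyMeasurable hgC
    have j1 := j _ hmψ.continuous (norm_mollify_le ρ hC)
    have j2 := j _ hψ.continuous hC
    rw [← integral_sub j1 j2]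
    simp only [sub_smul]
  rw [hR4, WithLp.sub_snd] at hT
  rw [hL, hT, integral_smul_mollifiedLift ρ hΩ hvol u h1 h2 hψ.continuous hC, hR2, WithLp.add_snd]
  abel

end LocalApproximation


/-! ### Summing over the partition of unity -/

section GlobalApproximation

variable {Ω : Set (Vec d)} {μ : VectorMeasure (Vec d) (SymMat d)}

theorem stronglyMeasurable_mollify (ρ : ContDiffBump (0 : Vec d)) {ψ : Vec d → ℝ}
    (hψ : Continuous ψ) : StronglyMeasurable (mollify ρ volume ψ) := by
  have h : Continuous (Function.uncurry fun x y : Vec d => ρ.normed volume (x - y) • ψ y) :=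
    (ρ.continuous_normed.comp (continuous_fst.sub continuous_snd)).smul (hψ.comp continuous_snd)
  exact h.stronglyMeasurable.integral_prod_right

/-- By duality the mollification falls on `ψ`, which changes by at most `τ` at the scale of the
bump; the correction term is at most `η` in `L¹`. -/
theorem norm_integral_smul_mollifiedLift_sub_le [IsFiniteMeasure μ.variation]
    (ρ : ContDiffBump (0 : Vec d)) {φ : Vec d → ℝ} (hΩ : MeasurableSet Ω)
    (hvol : volume Ω ≠ ⊤) (u : Lp (Vec d) 1 (volume.restrict Ω)) (h1 : ContDiff ℝ ∞ φ)
    (h2 : HasCompactSupport φ) (h0 : ∀ x, 0 ≤ φ x) {η : ℝ}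
    (hη : ∫ x, ‖mollify ρ volume (cutoffField Ω u φ) x - cutoffField Ω u φ x‖ ≤ η)
    {ψ : Vec d → ℝ} (hψ : Continuous ψ) {C τ : ℝ}
    (hC : ∀ x, ‖ψ x‖ ≤ C) (hτ : ∀ x y, dist y x < ρ.rOut → ‖ψ y - ψ x‖ ≤ τ) :
    ‖(∫ x, ψ x • mollifiedLift ρ Ω u μ φ x) - ∫ x, ψ x • φ x • liftField μ x ∂(liftMeasure Ω μ)‖
      ≤ τ * (∫ x, φ x ∂(liftMeasure Ω μ)) + C * η := by
  have hm := isFiniteMeasure_liftMeasure (μ := μ) hvol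
  obtain ⟨C', hC'⟩ := h2.exists_bound_of_continuous h1.continuous
  have iν := integrable_smul_liftField (Ω := Ω) (μ := μ) hvol h1.continuous hC'
  have hC0 : 0 ≤ C := (norm_nonneg _).trans (hC 0)
  have i2 := integrable_cutoffField hΩ u h1 h2
  have i3 : Integrable (fun x => mollify ρ volume (cutoffField Ω u φ) x - cutoffField Ω u φ x)
    volume := (integrable_mollify ρ i2).sub i2
  have iφ : Integrable φ (liftMeasure Ω μ) :=
    Integrable.of_bound h1.continuous.aestronglyMeasurable C' (Eventually.of_forall hC')
  have j : ∀ g : Vec d → ℝ, StronglyMeasurable g → (∀ x, ‖g x‖ ≤ C) →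
      Integrable (fun x => g x • φ x • liftField μ x) (liftMeasure Ω μ) := fun g hg hgC =>
    integrable_bilin_of_bound (ContinuousLinearMap.lsmul ℝ ℝ).flip iν hg.aestronglyMeasurable hgC
  have j1 := j _ (stronglyMeasurable_mollify ρ hψ) (norm_mollify_le ρ hC)
  have j2 := j _ hψ.stronglyMeasurable hC
  rw [integral_smul_mollifiedLift ρ hΩ hvol u h1 h2 hψ hC, add_sub_right_comm,
    ← integral_sub j1 j2]
  refine (norm_add_le _ _).trans (add_le_add ?_ ?_)
  · rw [← integral_const_mul]
    refine norm_integral_le_of_norm_le (iφ.const_mul τ) ?_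
    filter_upwards [norm_liftField (Ω := Ω) (μ := μ)] with x hx
    rw [← sub_smul, norm_smul, norm_smul, hx, mul_one, Real.norm_of_nonneg (h0 x)]
    exact mul_le_mul_of_nonneg_right (norm_mollify_sub_le ρ hψ fun y hy => hτ x y hy) (h0 x)
  · calc _ ≤ ∫ x, C * ‖mollify ρ volume (cutoffField Ω u φ) x - cutoffField Ω u φ x‖ := by
          refine norm_integral_le_of_norm_le (i3.norm.const_mul C) (Eventually.of_forall fun x => ?_)
          rw [norm_smul]
          exact mul_le_mul_of_nonneg_right (hC x) (norm_nonneg _)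
      _ ≤ C * η := by
          rw [integral_const_mul]
          exact mul_le_mul_of_nonneg_left hη hC0

theorem exists_bump_rOut_eq {ε : ℝ} (hε : 0 < ε) :
    ∃ ρ : ContDiffBump (0 : Vec d), ρ.rOut = ε :=
  ⟨⟨ε / 2, ε, by positivity, by linarith⟩, rfl⟩

/-- The data of a smooth approximation of a function of bounded deformation: the perturbation `a`
and the lift `Z` of the symmetrized derivative of `u + a`. -/
theorem exists_perturbation {u : Lp (Vec d) 1 (volume.restrict Ω)}
    (hu : IsSymDeriv Ω u μ) (hΩ : IsOpen Ω) (hvol : volume Ω ≠ ⊤) {δ : ℝ} (hδ : 0 < δ) :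
    ∃ (a : Vec d → Vec d) (Z : Vec d → LiftVec d), Integrable a volume ∧ Integrable Z volume ∧
      ∫ x, ‖a x‖ ≤ δ ∧ ∫ x, ‖Z x‖ ≤ area Ω μ + δ ∧ (∀ᵐ x, x ∈ Ω → (Z x).fst = 1) ∧
      (∀ ψ : Vec d → ℝ, ContDiff ℝ ∞ ψ → HasCompactSupport ψ →
        ∫ x, symTensor d (a x) (fderiv ℝ ψ x)
          = (∫ x, ψ x • liftField μ x ∂(liftMeasure Ω μ)).snd - (∫ x, ψ x • Z x).snd) ∧
      ∀ ψ : Vec d → ℝ, Continuous ψ → ∀ C τ : ℝ, (∀ x, ‖ψ x‖ ≤ C) →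
        (∀ x y, dist y x < δ → ‖ψ y - ψ x‖ ≤ τ) →
        ‖(∫ x, ψ x • Z x) - ∫ x, ψ x • liftField μ x ∂(liftMeasure Ω μ)‖
          ≤ τ * area Ω μ + C * δ := by
  have := hu.finite
  have hm := isFiniteMeasure_liftMeasure (μ := μ) hvol
  have hΩm := hΩ.measurableSet
  obtain ⟨φ, h1, h2, h3, h0, hsum⟩ := exists_smooth_partition hΩ
  -- A geometric series with sum `δ`. One bump per index must serve two fields, so its radius is the
  -- minimum of both thresholds and of `δ`.
  set ε : ℕ → ℝ := fun k => δ / 2 / 2 ^ k with hε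
  have hε0 : ∀ k, 0 < ε k := fun k => by positivity
  have hεs : HasSum ε δ := hasSum_geometric_two' δ
  have hρ : ∀ k, ∃ ρ : ContDiffBump (0 : Vec d), ρ.rOut ≤ δ ∧
      ∫ x, ‖mollify ρ volume (fun y => φ k y • Ω.indicator u y) x - φ k x • Ω.indicator u x‖ ≤ ε k ∧
      ∫ x, ‖mollify ρ volume (cutoffField Ω u (φ k)) x - cutoffField Ω u (φ k) x‖ ≤ ε k := by
    intro k
    obtain ⟨r, hr, hr'⟩ := exists_integral_norm_mollify_sub_le
      (integrable_indicator_smul hΩm u (h1 k).continuous (h2 k)) (hε0 k)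
    obtain ⟨s, hs, hs'⟩ := exists_integral_norm_mollify_sub_le
      (integrable_cutoffField hΩm u (h1 k) (h2 k)) (hε0 k)
    obtain ⟨ρ, hρ⟩ := exists_bump_rOut_eq (d := d) (lt_min hδ (lt_min hr hs))
    exact ⟨ρ, hρ.le.trans (min_le_left _ _),
      hr' ρ (hρ.le.trans ((min_le_right _ _).trans (min_le_left _ _))),
      hs' ρ (hρ.le.trans ((min_le_right _ _).trans (min_le_right _ _)))⟩
  choose ρ hρδ hρa hρQ using hρ
  set M : ℕ → ℝ := fun k => ∫ x, φ k x ∂(liftMeasure Ω μ) with hM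
  have hcar : ∀ᵐ x ∂(liftMeasure Ω μ), x ∈ Ω := by
    filter_upwards [measure_eq_zero_iff_ae_notMem.1 (liftMeasure_compl hΩm hu.carried)] with x hx
    simpa using hx
  have iφ : ∀ k, Integrable (φ k) (liftMeasure Ω μ) := fun k => by
    obtain ⟨C', hC'⟩ := (h2 k).exists_bound_of_continuous (h1 k).continuous
    exact Integrable.of_bound (h1 k).continuous.aestronglyMeasurable C' (Eventually.of_forall hC')
  have hM0 : ∀ k, 0 ≤ M k := fun k => integral_nonneg fun x => h0 k x
  -- Partial sums of the partition are at most 1 on `Ω`, so the masses `M k` add up to at most the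
  -- total lifted mass.
  have hMle : ∀ n, ∑ k ∈ Finset.range n, M k ≤ area Ω μ := fun n => by
    rw [hM, ← integral_finsetSum _ fun k _ => iφ k, ← liftMeasure_real_univ hvol hu.carried]
    calc _ ≤ ∫ x, (1 : ℝ) ∂(liftMeasure Ω μ) := by
          refine integral_mono_ae (integrable_finsetSum _ fun k _ => iφ k) (integrable_const _) ?_
          filter_upwards [hcar] with x hx
          exact sum_le_hasSum _ (fun k _ => h0 k x) (hsum x hx)
      _ = _ := by simp
  have hMs : Summable M := summable_of_sum_range_le hM0 hMle
  have hMt : ∑' k, M k ≤ area Ω μ := Real.tsum_le_of_sum_range_le hM0 hMle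
  -- the two series
  have ia : ∀ k, Integrable (fun x => mollify (ρ k) volume (fun y => φ k y • Ω.indicator u y) x
      - φ k x • Ω.indicator u x) volume := fun k =>
    (integrable_mollify _ (integrable_indicator_smul hΩm u (h1 k).continuous (h2 k))).sub
      (integrable_indicator_smul hΩm u (h1 k).continuous (h2 k))
  obtain ⟨a, ha1, ha2, ha3⟩ := exists_integrable_hasSum ia hεs.summable hρa
  have iZ : ∀ k, Integrable (mollifiedLift (ρ k) Ω u μ (φ k)) volume := fun k =>
    integrable_mollifiedLift (ρ k) hΩm hvol u (h1 k) (h2 k)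
  have hZle : ∀ k, ∫ x, ‖mollifiedLift (ρ k) Ω u μ (φ k) x‖ ≤ M k + ε k := fun k =>
    integral_norm_mollifiedLift_le (ρ k) hΩm hvol u (h1 k) (h2 k) (h0 k) (hρQ k)
  obtain ⟨Z, hZ1, hZ2, hZ3⟩ := exists_integrable_hasSum iZ (hMs.add hεs.summable) hZle
  have iν : ∀ k, Integrable (fun x => φ k x • liftField μ x) (liftMeasure Ω μ) := fun k => by
    obtain ⟨C', hC'⟩ := (h2 k).exists_bound_of_continuous (h1 k).continuous
    exact integrable_smul_liftField hvol (h1 k).continuous hC'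
  have hνle : ∀ k, ∫ x, ‖φ k x • liftField μ x‖ ∂(liftMeasure Ω μ) ≤ M k := fun k => by
    refine le_of_eq (integral_congr_ae ?_)
    filter_upwards [norm_liftField (Ω := Ω) (μ := μ)] with x hx
    rw [norm_smul, hx, mul_one, Real.norm_of_nonneg (h0 k x)]
  have hνs : ∀ᵐ x ∂(liftMeasure Ω μ), HasSum (fun k => φ k x • liftField μ x) (liftField μ x) := by
    filter_upwards [hcar] with x hx
    simpa using (hsum x hx).smul_const (liftField μ x)
  have sZ : ∀ ψ : Vec d → ℝ, Continuous ψ → ∀ C : ℝ, (∀ x, ‖ψ x‖ ≤ C) →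
      HasSum (fun k => ∫ x, ψ x • mollifiedLift (ρ k) Ω u μ (φ k) x) (∫ x, ψ x • Z x) :=
    fun ψ hψ C hC => hasSum_integral_bilin (ContinuousLinearMap.lsmul ℝ ℝ).flip iZ
      (hMs.add hεs.summable) hZle hZ2 hψ.aestronglyMeasurable hC
  have sν : ∀ ψ : Vec d → ℝ, Continuous ψ → ∀ C : ℝ, (∀ x, ‖ψ x‖ ≤ C) →
      HasSum (fun k => ∫ x, ψ x • φ k x • liftField μ x ∂(liftMeasure Ω μ))
        (∫ x, ψ x • liftField μ x ∂(liftMeasure Ω μ)) :=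
    fun ψ hψ C hC => hasSum_integral_bilin (ContinuousLinearMap.lsmul ℝ ℝ).flip iν
      hMs hνle hνs hψ.aestronglyMeasurable hC
  refine ⟨a, Z, ha1, hZ1, ha3.trans hεs.tsum_eq.le, ?_, ?_, fun ψ hψ hψc => ?_,
    fun ψ hψ C τ hC hτ => ?_⟩
  · rw [hMs.tsum_add hεs.summable, hεs.tsum_eq] at hZ3
    linarith
  · filter_upwards [hZ2] with x hx hxΩ
    have h := hx.mapL (WithLp.fstL 2 ℝ ℝ (SymMat d))
    simp only [WithLp.fstL_apply,
      fst_mollifiedLift _ hΩm hvol hu.carried u (h1 _) (h2 _) (h3 _)] at h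
    exact h.unique (hsum x hxΩ)
  -- Each term satisfies the identity with `φ k` times the lift; both sides are summed, and the
  -- partition of unity restores the full lift.
  · obtain ⟨C, hC⟩ := hψc.exists_bound_of_continuous hψ.continuous
    obtain ⟨hd, D, hD⟩ := exists_bound_fderiv hψ hψc
    have s1 := hasSum_integral_bilin (symTensor d) ia hεs.summable hρa ha2
      hd.aestronglyMeasurable hD
    simp only [integral_symTensor_mollify_sub _ hu hΩm hvol (h1 _) (h2 _) (h3 _) hψ hψc] at s1
    exact s1.unique (((sν ψ hψ.continuous C hC).mapL (WithLp.sndL 2 ℝ ℝ (SymMat d))).sub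
      ((sZ ψ hψ.continuous C hC).mapL (WithLp.sndL 2 ℝ ℝ (SymMat d))))
  · have hτ0 : 0 ≤ τ := (norm_nonneg _).trans (hτ 0 0 (by simpa using hδ))
    refine (((sZ ψ hψ C hC).sub (sν ψ hψ C hC)).norm_le_of_bounded
      ((hMs.hasSum.mul_left τ).add (hεs.mul_left C)) fun k => ?_).trans ?_
    · exact norm_integral_smul_mollifiedLift_sub_le (ρ k) hΩm hvol u (h1 k) (h2 k) (h0 k)
        (hρQ k) hψ hC fun x y hxy => hτ x y (hxy.trans_le (hρδ k))
    · gcongr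

end GlobalApproximation


/-! ### Strict density of `LD(Ω)` and uniqueness of the extension -/

section SmoothDensity

variable {Ω : Set (Vec d)}

theorem area_withDensityᵥ (hΩ : MeasurableSet Ω) {e : Vec d → SymMat d}
    (he : Integrable e volume) :
    area Ω (volume.withDensityᵥ (Ω.indicator e)) = ∫ x in Ω, √(1 + ‖e x‖ ^ 2) := by
  obtain ⟨h1, h2⟩ := density_withDensityᵥ (he.indicator hΩ)
  have h3 : (0 : VectorMeasure (Vec d) (SymMat d)).variation = 0 :=
    VectorMeasure.variation_eq_zero.2 rfl
  rw [area, h2, h3, Measure.real, Measure.coe_zero, Pi.zero_apply, ENNReal.toReal_zero, add_zero]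
  refine integral_congr_ae ?_
  filter_upwards [ae_restrict_of_ae h1, ae_restrict_mem hΩ] with x hx hxΩ
  rw [hx, Set.indicator_of_mem hxΩ]

theorem variation_withDensityᵥ_indicator_compl (hΩ : MeasurableSet Ω) {e : Vec d → SymMat d}
    (he : Integrable e volume) : (volume.withDensityᵥ (Ω.indicator e)).variation Ωᶜ = 0 := by
  rw [Measure.variation_withDensityᵥ (he.indicator hΩ), withDensity_apply _ hΩ.compl]
  refine (setLIntegral_congr_fun hΩ.compl fun x hx => ?_).trans lintegral_zero
  simp [Set.indicator_of_notMem hx]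

theorem integral_withDensityᵥ_indicator_snd (hΩ : MeasurableSet Ω) {Z : Vec d → LiftVec d}
    (hZ : Integrable Z volume) {ψ : Vec d → ℝ} (hψ : Continuous ψ) {C : ℝ}
    (hC : ∀ x, ‖ψ x‖ ≤ C) (h0 : ∀ x ∉ Ω, ψ x = 0) :
    ∫ᵛ x, ψ x ∂•(volume.withDensityᵥ (Ω.indicator fun x => (Z x).snd))
      = (∫ x, ψ x • Z x).snd := by
  have hZs : Integrable (fun x => (Z x).snd) volume :=
    (WithLp.sndL 2 ℝ ℝ (SymMat d)).integrable_comp hZ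
  have i : Integrable (fun x => ψ x • Z x) volume :=
    hZ.bdd_smul C hψ.aestronglyMeasurable (Eventually.of_forall hC)
  rw [integral_withDensityᵥ_smul (hZs.indicator hΩ) hψ.stronglyMeasurable hC,
    ← WithLp.sndL_apply (𝕜 := ℝ), ← ContinuousLinearMap.integral_comp_comm _ i]
  refine integral_congr_ae (Eventually.of_forall fun x => ?_)
  by_cases hx : x ∈ Ω
  · simp [hx]
  · simp [h0 x hx]

theorem integral_smul_liftField_snd {μ : VectorMeasure (Vec d) (SymMat d)}
    [IsFiniteMeasure μ.variation] (hΩ : MeasurableSet Ω)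
    (hvol : volume Ω ≠ ⊤) (hμ : μ.variation Ωᶜ = 0) {ψ : Vec d → ℝ} (hψ : Continuous ψ) {C : ℝ}
    (hC : ∀ x, ‖ψ x‖ ≤ C) :
    ∫ᵛ x, ψ x ∂•μ = (∫ x, ψ x • liftField μ x ∂(liftMeasure Ω μ)).snd := by
  rw [integral_smul_liftField hΩ hvol hμ hψ.stronglyMeasurable hC]
  rfl

theorem norm_snd_le (z : LiftVec d) : ‖z.snd‖ ≤ ‖z‖ := by
  rw [WithLp.prod_norm_eq_of_L2]
  exact Real.le_sqrt_of_sq_le (le_add_of_nonneg_left (sq_nonneg _))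

/-- The identity `h` says that `a` has symmetrized derivative `Z.snd dx - μ`; adding `u` cancels
`μ`. -/
theorem isSymDeriv_of_perturbation {μ : VectorMeasure (Vec d) (SymMat d)}
    {u v : Lp (Vec d) 1 (volume.restrict Ω)} (hu : IsSymDeriv Ω u μ) (hΩ : MeasurableSet Ω)
    (hvol : volume Ω ≠ ⊤) {a : Vec d → Vec d} {Z : Vec d → LiftVec d} (ha : Integrable a volume)
    (hZ : Integrable Z volume) (hv : ∀ᵐ x ∂(volume.restrict Ω), v x = u x + a x)
    (h : ∀ ψ : Vec d → ℝ, ContDiff ℝ ∞ ψ → HasCompactSupport ψ →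
        ∫ x, symTensor d (a x) (fderiv ℝ ψ x)
          = (∫ x, ψ x • liftField μ x ∂(liftMeasure Ω μ)).snd - (∫ x, ψ x • Z x).snd) :
    IsSymDeriv Ω v (volume.withDensityᵥ (Ω.indicator fun x => (Z x).snd)) := by
  have := hu.finite
  have hZs : Integrable (fun x => (Z x).snd) volume :=
    (WithLp.sndL 2 ℝ ℝ (SymMat d)).integrable_comp hZ
  refine ⟨?_, variation_withDensityᵥ_indicator_compl hΩ hZs, fun ψ h1 h2 h3 i j => ?_⟩
  · rw [Measure.variation_withDensityᵥ (hZs.indicator hΩ)]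
    exact isFiniteMeasure_withDensity (hZs.indicator hΩ).2.ne
  obtain ⟨C, hC⟩ := h2.exists_bound_of_continuous h1.continuous
  obtain ⟨hd, D, hD⟩ := exists_bound_fderiv h1 h2
  rw [← entry_integral_symTensor hΩ v h1 h2, ← SymMat.entry_neg,
    integral_withDensityᵥ_indicator_snd hΩ hZ h1.continuous hC fun x hx =>
      image_eq_zero_of_notMem_tsupport fun hx' => hx (h3 hx')]
  congr 1
  have e1 : ∫ x, symTensor d (Ω.indicator v x) (fderiv ℝ ψ x)
      = ∫ x, (symTensor d (Ω.indicator u x) (fderiv ℝ ψ x)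
        + symTensor d (a x) (fderiv ℝ ψ x)) := by
    refine integral_congr_ae ?_
    filter_upwards [(ae_restrict_iff' hΩ).1 hv] with x hx
    by_cases hxΩ : x ∈ Ω
    · simp only [Set.indicator_of_mem hxΩ, hx hxΩ, map_add, add_apply]
    · have : fderiv ℝ ψ x = 0 := image_eq_zero_of_notMem_tsupport fun hx' =>
        hxΩ (h3 (tsupport_fderiv_subset ℝ hx'))
      simp [this]
  rw [e1, integral_add (integrable_bilin_of_bound (symTensor d) (integrable_indicator_Lp hΩ u)
    hd.aestronglyMeasurable hD) (integrable_bilin_of_bound (symTensor d) ha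
    hd.aestronglyMeasurable hD), h ψ h1 h2, hu.integral_symTensor hΩ h1 h2 h3,
    integral_smul_liftField_snd hΩ hvol hu.carried h1.continuous hC]
  abel

namespace BD

/-- Quantitative density of `LD(Ω)` in `BD(Ω)`. -/
theorem exists_isLD_approximation (hΩ : IsOpen Ω) (hvol : volume Ω ≠ ⊤) (u : BD Ω) {δ : ℝ}
    (hδ : 0 < δ) : ∃ v : BD Ω, v.IsLD ∧ ‖v.1 - u.1‖ ≤ δ ∧
      area Ω v.symDeriv ≤ area Ω u.symDeriv + δ ∧
      ∀ ψ : Vec d → ℝ, Continuous ψ → (∀ x ∉ Ω, ψ x = 0) → ∀ C τ : ℝ, (∀ x, ‖ψ x‖ ≤ C) →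
        (∀ x y, dist y x < δ → ‖ψ y - ψ x‖ ≤ τ) →
        ‖∫ᵛ x, ψ x ∂•v.symDeriv - ∫ᵛ x, ψ x ∂•u.symDeriv‖ ≤ τ * area Ω u.symDeriv + C * δ := by
  have hu := u.isSymDeriv
  have := hu.finite
  have hΩm := hΩ.measurableSet
  obtain ⟨a, Z, ha, hZ, ha1, hZ1, hZ2, hZ3, hZ4⟩ := exists_perturbation hu hΩ hvol hδ
  have hZs : Integrable (fun x => (Z x).snd) volume :=
    (WithLp.sndL 2 ℝ ℝ (SymMat d)).integrable_comp hZ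
  set a' : Lp (Vec d) 1 (volume.restrict Ω) := (ha.integrableOn (s := Ω)).toL1 with ha'
  have hcoe : ∀ᵐ x ∂(volume.restrict Ω), a' x = a x := (ha.integrableOn (s := Ω)).coeFn_toL1
  have hv : ∀ᵐ x ∂(volume.restrict Ω), (u.1 + a') x = u.1 x + a x := by
    filter_upwards [Lp.coeFn_add u.1 a', hcoe] with x h1 h2
    rw [h1, Pi.add_apply, h2]
  have hsym := isSymDeriv_of_perturbation hu hΩm hvol ha hZ hv hZ3
  set v : BD Ω := ⟨u.1 + a', _, hsym⟩ with hvdef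
  have hE : v.symDeriv = volume.withDensityᵥ (Ω.indicator fun x => (Z x).snd) :=
    IsSymDeriv.unique hΩ v.isSymDeriv hsym
  refine ⟨v, ?_, ?_, ?_, fun ψ hψ h0 C τ hC hτ => ?_⟩
  · rw [IsLD, singularDeriv, hE]
    exact (density_withDensityᵥ (hZs.indicator hΩm)).2
  · have : v.1 - u.1 = a' := add_sub_cancel_left _ _
    rw [this, L1.norm_eq_integral_norm]
    calc ∫ x in Ω, ‖a' x‖ = ∫ x in Ω, ‖a x‖ := by
          refine integral_congr_ae ?_
          filter_upwards [hcoe] with x hx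
          rw [hx]
      _ ≤ ∫ x, ‖a x‖ := setIntegral_le_integral ha.norm (Eventually.of_forall fun x => norm_nonneg _)
      _ ≤ δ := ha1
  · rw [hE, area_withDensityᵥ hΩm hZs]
    -- Since the first coordinate of `Z` is 1 on `Ω`, the area integrand is the Euclidean norm of
    -- `Z`.
    calc ∫ x in Ω, √(1 + ‖(Z x).snd‖ ^ 2) = ∫ x in Ω, ‖Z x‖ := by
          refine integral_congr_ae ?_
          filter_upwards [ae_restrict_of_ae hZ2, ae_restrict_mem hΩm] with x hx hxΩ
          rw [WithLp.prod_norm_eq_of_L2, hx hxΩ, norm_one, one_pow]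
      _ ≤ ∫ x, ‖Z x‖ := setIntegral_le_integral hZ.norm (Eventually.of_forall fun x => norm_nonneg _)
      _ ≤ _ := hZ1
  · rw [hE, integral_withDensityᵥ_indicator_snd hΩm hZ hψ hC h0,
      integral_smul_liftField_snd hΩm hvol hu.carried hψ hC, ← WithLp.sub_snd]
    exact (norm_snd_le _).trans (hZ4 ψ hψ C τ hC hτ)

/-- `LD(Ω)` is dense in `BD(Ω)` for strict convergence. -/
theorem exists_isLD_strictTendsto (hΩ : IsOpen Ω) (hvol : volume Ω ≠ ⊤) (u : BD Ω) :
    ∃ v : ℕ → BD Ω, (∀ n, (v n).IsLD) ∧ StrictTendsto v u := by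
  choose v h1 h2 h3 h4 using fun n : ℕ =>
    u.exists_isLD_approximation hΩ hvol (Nat.one_div_pos_of_nat (n := n) (α := ℝ))
  have hδ : Tendsto (fun n : ℕ => 1 / ((n : ℝ) + 1)) atTop (𝓝 0) :=
    tendsto_one_div_add_atTop_nhds_zero_nat
  have hweak : ∀ ψ : ZeroAtInftyContinuousMap (Vec d) ℝ, (∀ x ∉ Ω, ψ x = 0) →
      Tendsto (fun k => ∫ᵛ x, ψ x ∂•(v k).symDeriv) atTop (𝓝 (∫ᵛ x, ψ x ∂•u.symDeriv)) := by
    intro ψ hψ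
    obtain ⟨C, hC⟩ : ∃ C, ∀ x, ‖ψ x‖ ≤ C :=
      ⟨‖ψ.toBCF‖, fun x => ψ.toBCF.norm_coe_le_norm x⟩
    have hA : 0 ≤ area Ω u.symDeriv :=
      add_nonneg (integral_nonneg fun x => Real.sqrt_nonneg _) measureReal_nonneg
    rw [Metric.tendsto_atTop]
    intro η hη
    -- Functions in `C₀` are uniformly continuous, so any `τ` is available at small scale; this one
    -- bounds `τ * area` by `η / 2`, and `C * δ` gets the other half.
    set τ := η / 2 / (area Ω u.symDeriv + 1) with hτ
    have hτ0 : 0 < τ := by positivity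
    obtain ⟨ε, hε, hψε⟩ := Metric.uniformContinuous_iff.1 (ZeroAtInftyContinuousMap.uniformContinuous ψ) τ hτ0
    have hCδ : Tendsto (fun n : ℕ => C * (1 / ((n : ℝ) + 1))) atTop (𝓝 0) := by
      simpa using hδ.const_mul C
    obtain ⟨N, hN⟩ := eventually_atTop.1 ((hδ.eventually_lt_const hε).and
      (hCδ.eventually_lt_const (half_pos hη)))
    refine ⟨N, fun n hn => ?_⟩
    obtain ⟨hn1, hn2⟩ := hN n hn
    rw [dist_eq_norm]
    refine (h4 n ψ ψ.continuous hψ C τ hC fun x y hxy => ?_).trans_lt ?_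
    · rw [← dist_eq_norm]
      exact (hψε (hxy.trans hn1)).le
    · have : τ * area Ω u.symDeriv ≤ η / 2 := by
        calc τ * area Ω u.symDeriv ≤ τ * (area Ω u.symDeriv + 1) := by gcongr; linarith
          _ = η / 2 := by rw [hτ]; field_simp
      linarith
  have := u.isSymDeriv.finite
  refine ⟨v, h1, ?_, hweak, ?_⟩
  · rw [tendsto_iff_norm_sub_tendsto_zero]
    exact squeeze_zero (fun n => norm_nonneg _) h2 hδ
  -- The lower bound is semicontinuity under the weak* convergence just shown; the upper bound is
  -- built into the approximation.
  · rw [tendsto_order]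
    refine ⟨fun b hb => eventually_lt_area (fun j => (v j).isSymDeriv.finite) hΩ hvol
      u.isSymDeriv.carried (fun j => (v j).isSymDeriv.carried) (fun k hk hc hs => ?_) hb,
      fun b hb => ?_⟩
    · exact hweak ⟨⟨k, hk⟩, hc.is_zero_at_infty⟩
        fun x hx => image_eq_zero_of_notMem_tsupport fun hx' => hx (hs hx')
    · filter_upwards [hδ.eventually_lt_const (sub_pos.2 hb)] with n hn
      linarith [h3 n]

theorem eq_of_strictlyContinuous (hΩ : IsOpen Ω) (hvol : volume Ω ≠ ⊤) {G H : BD Ω → ℝ}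
    (hG : StrictlyContinuous G) (hH : StrictlyContinuous H) (h : ∀ u : BD Ω, u.IsLD → H u = G u) :
    H = G := by
  ext u
  obtain ⟨v, h1, h2⟩ := u.exists_isLD_strictTendsto hΩ hvol
  refine tendsto_nhds_unique (hH v u h2) ?_
  simpa only [h _ (h1 _)] using hG v u h2

end BD

end SmoothDensity

end BoundedDeformation

end

/-! ### The main theorem -/

open BoundedDeformation in
theorem mainTheorem12 (d : ℕ) (Ω : Set (Vec d)) (hΩ : IsOpen Ω) (hvol : volume Ω ≠ ⊤)
    (f : Vec d → SymMat d → ℝ) (hf : IsIntegrand Ω f) :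
    -- the recession function exists
    (∀ x ∈ closure Ω, ∀ A : SymMat d, HasRecession Ω f x A (recession Ω f x A)) ∧
    -- both integrals converge absolutely, for every `u ∈ BD(Ω)`
    (∀ u : BD Ω,
      IntegrableOn (fun x => f x (u.approxSymGrad x)) Ω volume ∧
      IntegrableOn
        (fun x => recession Ω f x (density u.singularDeriv u.singularDeriv.variation x))
        Ω u.singularDeriv.variation) ∧
    BD.IsStrictExtension
      (fun u : {u : BD Ω // u.IsLD} => ∫ x in Ω, f x (u.1.approxSymGrad x))
      (fun u : BD Ω => (∫ x in Ω, f x (u.approxSymGrad x)) +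
        ∫ x in Ω, recession Ω f x (density u.singularDeriv u.singularDeriv.variation x)
          ∂u.singularDeriv.variation) := by
  obtain ⟨h, C, hC0, hcont, hle, hsmul, hhf⟩ := hf.exists_perspective
  have hC : ∀ x ∈ closure Ω, ∀ z, ‖z‖ ≤ 1 → |h (x, z)| ≤ C := fun x hx z hz =>
    (hle x hx z).trans (mul_le_of_le_one_right hC0 hz)
  have hrec := fun u : BD Ω => BD.integral_recession hΩ hvol hcont hC hsmul hhf u
  have hext : ∀ u : BD Ω, u.IsLD → (∫ x in Ω, f x (u.approxSymGrad x)) +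
      ∫ x in Ω, recession Ω f x (density u.singularDeriv u.singularDeriv.variation x)
        ∂u.singularDeriv.variation = ∫ x in Ω, f x (u.approxSymGrad x) := by
    intro u hu
    have hv : u.singularDeriv.variation = 0 := VectorMeasure.variation_eq_zero.2 hu
    rw [hv, Measure.restrict_zero, integral_zero_measure, add_zero]
  have hcts : BD.StrictlyContinuous (fun u : BD Ω => (∫ x in Ω, f x (u.approxSymGrad x)) +
      ∫ x in Ω, recession Ω f x (density u.singularDeriv u.singularDeriv.variation x)
        ∂u.singularDeriv.variation) := by
    intro v u huv
    -- Once rewritten against the lift, the functional has one homogeneous integrand, continuous on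
    -- `Ω × (ℝ × ℝ^{d×d}_sym)` and bounded on the unit ball, and Reshetnyak's theorem applies.
    simp only [fun u => (hrec u).2.2]
    exact (huv.strictConvergence hΩ hvol).tendsto_integral_comp
      (hcont.mono (Set.prod_mono subset_closure subset_rfl))
      fun x hx => hC x (subset_closure hx)
  refine ⟨fun x hx A => ?_, fun u => ⟨(hrec u).1, (hrec u).2.1⟩, fun u => hext u.1 u.2, hcts,
    fun H hH hHc => ?_⟩
  · rw [recession_eq_of_perspective hcont hsmul hhf hx]
    exact hasRecession_of_perspective hcont hsmul hhf hx A
  · exact BD.eq_of_strictlyContinuous hΩ hvol hcts hHc fun u hu =>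
      (hH ⟨u, hu⟩).trans (hext u hu).symm
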